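/- Let $a,b,s\in\mathbb{R}$ with $s\neq 0$. Let $\mathcal H^0=L^2(0,1)\times L^2(0,1)$ be the real Hilbert space with inner product $\langle (f_1,g_1),(f_2,g_2)\rangle=\int_0^1 (f_1f_2+g_1g_2)\,dx$, and let $\mathcal A$ be the unbounded operator on $\mathcal H^0$ given by $$\mathcal A(f,g)=(f''+af,\;g''+bg),\qquad D(\mathcal A)=\{(f,g)\in H^2(0,1)\times H^2(0,1)\;:\; f(1)=g'(0)=g'(1)=0,\ f'(0)=s\,g(0)\}.$$ For $n,m\in\mathbb{N}=\{0,1,2,\dots\}$ put $\lambda_{1,n}=a-(n+\tfrac12)^2\pi^2$ and $\lambda_{2,m}=b-m^2\pi^2$. Let $\Delta(a,b)=\{(n,m)\in\mathbb{N}^2: 4(b-a)=(4m^2-(2n+1)^2)\pi^2\}$ and $\Delta_2(a,b)=\{m\in\mathbb N:\exists n\in\mathbb N,\ (n,m)\in\Delta(a,b)\}$; for $m\in\Delta_2(a,b)$ the integer $k$ with $(k,m)\in\Delta(a,b)$ is unique. Define $\phi_{1,n}(x)=\big(\sqrt2\cos((n+\tfrac12)\pi x),\,0\big)$ and $\phi_{2,m}=(\phi_{2,m}^1,\phi_{2,m}^2)$,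 where $\phi_{2,0}^2(x)=1$, $\phi_{2,m}^2(x)=\sqrt2\cos(m\pi x)$ for $m\ge1$, $\mu_m=\phi_{2,m}^2(0)$, and - if $m\notin\Delta_2(a,b)$ and $b-a=m^2\pi^2$: $\phi_{2,m}^1(x)=s\mu_m(x-1)$; - if $m\notin\Delta_2(a,b)$ and $b-a\neq m^2\pi^2$: $\phi_{2,m}^1(x)=-\dfrac{s\mu_m}{r_m\cosh r_m}\sinh(r_m(1-x))$, where $r_m\in\mathbb{C}$ is a square root of $b-a-m^2\pi^2$ (this function is real-valued and does not depend on the choice of the square root); - if $m\in\Delta_2(a,b)$ and $k$ is the integer with $(k,m)\in\Delta(a,b)$: $\phi_{2,m}^1(x)=\dfrac{s\mu_m}{(k+1/2)\pi}(1-x)\sin((k+\tfrac12)\pi x)$. Then each $\phi_{1,n}$ and each $\phi_{2,m}$ is a generalized eigenvector of $\mathcal A$, associated with $\lambda_{1,n}$ and $\lambda_{2,m}$ respectively, and the family $\Phi=\{\phi_{1,n}\}_{n\ge0}\cup\{\phi_{2,m}\}_{m\ge0}$ is a Riesz basis of $\mathcal H^0$, i.e. the image of an orthonormal Hilbert basis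 under a bounded, boundedly invertible linear operator of $\mathcal H^0$. Moreover, $\mathcal A$ is the infinitesimal generator of a $C_0$-semigroup on $\mathcal H^0$. -/

import Mathlib

open MeasureTheory Filter Topology Set
open scoped ContDiff NNReal

noncomputable section

namespace HeatCascade

/-! ### Function spaces on `(0,1)` -/

/-- Lebesgue measure on `(0,1)`. -/
abbrev mu01 : Measure ℝ := volume.restrict (Ioo (0 : ℝ) 1)

/-- The real Hilbert space `L²(0,1)`. -/
abbrev L2 : Type := Lp ℝ 2 mu01

/-- The real Hilbert space `L²(0,1) × L²(0,1)`, whose inner product is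
`⟨(f₁,g₁),(f₂,g₂)⟩ = ∫₀¹ (f₁ f₂ + g₁ g₂) dx`. -/
abbrev H0 : Type := WithLp 2 (L2 × L2)

theorem inner_H0 (u v : H0) :
    inner ℝ u v = ∫ x in Ioo (0 : ℝ) 1, (u.fst x * v.fst x + u.snd x * v.snd x) := by
  have key : ∀ f g : L2, Integrable (fun x => f x * g x) mu01 := fun f g => by
    have := L2.integrable_inner (𝕜 := ℝ) g f
    simpa using this
  rw [integral_add (key _ _) (key _ _), WithLp.prod_inner_apply]
  simp [L2.inner_def, mul_comm]

/-- `g` is the weak (distributional) derivative of `f` on `(0,1)`. -/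
def IsWeakDeriv (f g : L2) : Prop :=
  ∀ φ : ℝ → ℝ, ContDiff ℝ ∞ φ → HasCompactSupport φ → tsupport φ ⊆ Ioo (0 : ℝ) 1 →
    ∫ x in Ioo (0 : ℝ) 1, f x * deriv φ x = -∫ x in Ioo (0 : ℝ) 1, g x * φ x

theorem integrable_mul (f : L2) {φ : ℝ → ℝ} (hφ : Continuous φ) (hc : HasCompactSupport φ) :
    Integrable (fun x => f x * φ x) mu01 :=
  MemLp.integrable_mul (p := 2) (q := 2) (Lp.memLp f) (hφ.memLp_of_hasCompactSupport hc)

theorem IsWeakDeriv.add {f g f' g' : L2} (hf : IsWeakDeriv f f') (hg : IsWeakDeriv g g') :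
    IsWeakDeriv (f + g) (f' + g') := by
  intro φ h1 h2 h3
  have hd : Continuous (deriv φ) := h1.continuous_deriv (by simp)
  have e1 : (fun x => (f + g : L2) x * deriv φ x) =ᵐ[mu01]
      fun x => f x * deriv φ x + g x * deriv φ x := by
    filter_upwards [Lp.coeFn_add f g] with x hx
    rw [hx, Pi.add_apply, add_mul]
  have e2 : (fun x => (f' + g' : L2) x * φ x) =ᵐ[mu01]
      fun x => f' x * φ x + g' x * φ x := by
    filter_upwards [Lp.coeFn_add f' g'] with x hx
    rw [hx, Pi.add_apply, add_mul]
  rw [integral_congr_ae e1, integral_congr_ae e2,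
    integral_add (integrable_mul f hd h2.deriv) (integrable_mul g hd h2.deriv),
    integral_add (integrable_mul f' h1.continuous h2) (integrable_mul g' h1.continuous h2),
    hf φ h1 h2 h3, hg φ h1 h2 h3]
  ring

theorem IsWeakDeriv.smul (c : ℝ) {f f' : L2} (hf : IsWeakDeriv f f') :
    IsWeakDeriv (c • f) (c • f') := by
  intro φ h1 h2 h3
  have e1 : (fun x => (c • f : L2) x * deriv φ x) =ᵐ[mu01] fun x => c * (f x * deriv φ x) := by
    filter_upwards [Lp.coeFn_smul c f] with x hx
    rw [hx, Pi.smul_apply, smul_eq_mul, mul_assoc]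
  have e2 : (fun x => (c • f' : L2) x * φ x) =ᵐ[mu01] fun x => c * (f' x * φ x) := by
    filter_upwards [Lp.coeFn_smul c f'] with x hx
    rw [hx, Pi.smul_apply, smul_eq_mul, mul_assoc]
  rw [integral_congr_ae e1, integral_congr_ae e2, integral_const_mul, integral_const_mul,
    hf φ h1 h2 h3]
  ring

theorem isWeakDeriv_zero : IsWeakDeriv 0 0 := by
  have h : ∀ ψ : ℝ → ℝ, (fun x => (0 : L2) x * ψ x) =ᵐ[mu01] fun _ => 0 := fun ψ => by
    filter_upwards [Lp.coeFn_zero ℝ 2 mu01] with x hx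
    rw [hx, Pi.zero_apply, zero_mul]
  intro φ _ _ _
  rw [integral_congr_ae (h _), integral_congr_ae (h _)]
  simp

/-- The weak derivative is unique. -/
theorem IsWeakDeriv.unique {f g g' : L2} (h : IsWeakDeriv f g) (h' : IsWeakDeriv f g') :
    g = g' := by
  have hint : Integrable (fun x => (g x - g' x)) mu01 :=
    ((Lp.memLp g).integrable (by norm_num)).sub ((Lp.memLp g').integrable (by norm_num))
  have hae := isOpen_Ioo.ae_eq_zero_of_integral_contDiff_smul_eq_zero (μ := (volume : Measure ℝ))
    (U := Ioo (0 : ℝ) 1) (f := fun x => g x - g' x)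
    (IntegrableOn.locallyIntegrableOn hint) (by
      intro φ h1 h2 h3
      have hs : ∀ x, x ∉ Ioo (0 : ℝ) 1 → φ x • (g x - g' x) = 0 := by
        intro x hx
        rw [image_eq_zero_of_notMem_tsupport (fun hx' => hx (h3 hx')), zero_smul]
      rw [← setIntegral_eq_integral_of_forall_compl_eq_zero hs]
      have e : ∀ x, φ x • (g x - g' x) = g x * φ x - g' x * φ x := fun x => by
        rw [smul_eq_mul]; ring
      simp_rw [e]
      rw [integral_sub (integrable_mul g h1.continuous h2) (integrable_mul g' h1.continuous h2)]
      have := h φ h1 h2 h3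
      have := h' φ h1 h2 h3
      linarith)
  refine Lp.ext ?_
  rw [Filter.EventuallyEq, ae_restrict_iff' measurableSet_Ioo]
  filter_upwards [hae] with x hx hx'
  exact sub_eq_zero.mp (hx hx')

/-- The weak derivative of `f`, with the value `0` if `f` has none in `L²(0,1)`. -/
def weakDeriv (f : L2) : L2 :=
  open Classical in if h : ∃ g, IsWeakDeriv f g then h.choose else 0

theorem IsWeakDeriv.eq {f g : L2} (h : IsWeakDeriv f g) : weakDeriv f = g := by
  have hex : ∃ g, IsWeakDeriv f g := ⟨g, h⟩
  rw [weakDeriv, dif_pos hex]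
  exact hex.choose_spec.unique h

/-- `f ∈ H²(0,1)`: the function `f` and its first two weak derivatives are in `L²(0,1)`. -/
def MemH2 (f : L2) : Prop :=
  ∃ f₁ f₂ : L2, IsWeakDeriv f f₁ ∧ IsWeakDeriv f₁ f₂

theorem MemH2.isWeakDeriv {f : L2} (h : MemH2 f) : IsWeakDeriv f (weakDeriv f) := by
  obtain ⟨f₁, f₂, h1, -⟩ := h
  rwa [h1.eq]

theorem MemH2.isWeakDeriv₂ {f : L2} (h : MemH2 f) :
    IsWeakDeriv (weakDeriv f) (weakDeriv (weakDeriv f)) := by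
  obtain ⟨f₁, f₂, h1, h2⟩ := h
  rw [h1.eq]
  rwa [h2.eq]

theorem MemH2.zero : MemH2 0 := ⟨0, 0, isWeakDeriv_zero, isWeakDeriv_zero⟩

theorem MemH2.add {f g : L2} (hf : MemH2 f) (hg : MemH2 g) : MemH2 (f + g) :=
  ⟨_, _, hf.isWeakDeriv.add hg.isWeakDeriv, hf.isWeakDeriv₂.add hg.isWeakDeriv₂⟩

theorem MemH2.smul (c : ℝ) {f : L2} (hf : MemH2 f) : MemH2 (c • f) :=
  ⟨_, _, hf.isWeakDeriv.smul c, hf.isWeakDeriv₂.smul c⟩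

theorem weakDeriv_zero : weakDeriv 0 = 0 := isWeakDeriv_zero.eq

theorem MemH2.weakDeriv_add {f g : L2} (hf : MemH2 f) (hg : MemH2 g) :
    weakDeriv (f + g) = weakDeriv f + weakDeriv g := (hf.isWeakDeriv.add hg.isWeakDeriv).eq

theorem MemH2.weakDeriv_smul (c : ℝ) {f : L2} (hf : MemH2 f) :
    weakDeriv (c • f) = c • weakDeriv f := (hf.isWeakDeriv.smul c).eq

theorem MemH2.weakDeriv₂_add {f g : L2} (hf : MemH2 f) (hg : MemH2 g) :
    weakDeriv (weakDeriv (f + g)) = weakDeriv (weakDeriv f) + weakDeriv (weakDeriv g) := by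
  rw [hf.weakDeriv_add hg, (hf.isWeakDeriv₂.add hg.isWeakDeriv₂).eq]

theorem MemH2.weakDeriv₂_smul (c : ℝ) {f : L2} (hf : MemH2 f) :
    weakDeriv (weakDeriv (c • f)) = c • weakDeriv (weakDeriv f) := by
  rw [hf.weakDeriv_smul c, (hf.isWeakDeriv₂.smul c).eq]

/-- The representative of `f` that is continuous on `[0,1]` exists and takes the value `v` at the
point `x` (used for `x = 0` and `x = 1`). -/
def HasTrace (f : L2) (x v : ℝ) : Prop :=
  ∃ F : ℝ → ℝ, ContinuousOn F (Icc 0 1) ∧ f =ᵐ[mu01] F ∧ F x = v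

theorem HasTrace.zero (x : ℝ) : HasTrace 0 x 0 :=
  ⟨fun _ => 0, continuousOn_const, Lp.coeFn_zero ℝ 2 mu01, rfl⟩

theorem HasTrace.add {f g : L2} {x v w : ℝ} (hf : HasTrace f x v) (hg : HasTrace g x w) :
    HasTrace (f + g) x (v + w) := by
  obtain ⟨F, h1, h2, rfl⟩ := hf
  obtain ⟨G, h1', h2', rfl⟩ := hg
  exact ⟨F + G, h1.add h1', (Lp.coeFn_add f g).trans (h2.add h2'), rfl⟩

theorem HasTrace.smul (c : ℝ) {f : L2} {x v : ℝ} (hf : HasTrace f x v) :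
    HasTrace (c • f) x (c * v) := by
  obtain ⟨F, h1, h2, rfl⟩ := hf
  exact ⟨c • F, h1.const_smul c, (Lp.coeFn_smul c f).trans (h2.const_smul c), rfl⟩

/-! ### The coupled operator -/

/-- The domain of the operator: all `(f,g) ∈ H²(0,1) × H²(0,1)` with
`f(1) = g'(0) = g'(1) = 0` and `f'(0) = s g(0)`. -/
def opDomain (s : ℝ) : Submodule ℝ H0 where
  carrier := {u | MemH2 u.fst ∧ MemH2 u.snd ∧
    HasTrace u.fst 1 0 ∧ HasTrace (weakDeriv u.snd) 0 0 ∧ HasTrace (weakDeriv u.snd) 1 0 ∧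
    ∃ c : ℝ, HasTrace u.snd 0 c ∧ HasTrace (weakDeriv u.fst) 0 (s * c)}
  zero_mem' := by
    refine ⟨MemH2.zero, MemH2.zero, HasTrace.zero 1, ?_, ?_, 0, HasTrace.zero 0, ?_⟩ <;>
      simp [weakDeriv_zero, HasTrace.zero]
  add_mem' := by
    rintro u v ⟨h1, h2, h3, h4, h5, c, h6, h7⟩ ⟨k1, k2, k3, k4, k5, d, k6, k7⟩
    refine ⟨h1.add k1, h2.add k2, by simpa using h3.add k3, ?_, ?_, c + d, h6.add k6, ?_⟩
    · rw [WithLp.add_snd, h2.weakDeriv_add k2]; simpa using h4.add k4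
    · rw [WithLp.add_snd, h2.weakDeriv_add k2]; simpa using h5.add k5
    · rw [WithLp.add_fst, h1.weakDeriv_add k1, mul_add]; exact h7.add k7
  smul_mem' := by
    rintro r u ⟨h1, h2, h3, h4, h5, c, h6, h7⟩
    refine ⟨h1.smul r, h2.smul r, by simpa using h3.smul r, ?_, ?_, r * c, h6.smul r, ?_⟩
    · rw [WithLp.smul_snd, h2.weakDeriv_smul r]; simpa using h4.smul r
    · rw [WithLp.smul_snd, h2.weakDeriv_smul r]; simpa using h5.smul r
    · rw [WithLp.smul_fst, h1.weakDeriv_smul r, mul_left_comm]; exact h7.smul r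

/-- The unbounded operator `(f,g) ↦ (f'' + a f, g'' + b g)` on `L²(0,1) × L²(0,1)`. -/
def coupledOp (a b s : ℝ) : H0 →ₗ.[ℝ] H0 where
  domain := opDomain s
  toFun :=
    { toFun := fun u => WithLp.toLp 2
        (weakDeriv (weakDeriv u.1.fst) + a • u.1.fst, weakDeriv (weakDeriv u.1.snd) + b • u.1.snd)
      map_add' := by
        rintro ⟨u, hu⟩ ⟨v, hv⟩
        rw [← WithLp.toLp_add]
        congr 1
        refine Prod.ext ?_ ?_
        · simp only [Submodule.coe_add, WithLp.add_fst, Prod.fst_add, MemH2.weakDeriv₂_add hu.1 hv.1,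
            smul_add]
          abel
        · simp only [Submodule.coe_add, WithLp.add_snd, Prod.snd_add,
            MemH2.weakDeriv₂_add hu.2.1 hv.2.1, smul_add]
          abel
      map_smul' := by
        rintro c ⟨u, hu⟩
        rw [RingHom.id_apply, ← WithLp.toLp_smul]
        congr 1
        refine Prod.ext ?_ ?_
        · simp only [Submodule.coe_smul, WithLp.smul_fst, Prod.smul_fst,
            MemH2.weakDeriv₂_smul c hu.1, smul_add, smul_comm a c]
        · simp only [Submodule.coe_smul, WithLp.smul_snd, Prod.smul_snd,
            MemH2.weakDeriv₂_smul c hu.2.1, smul_add, smul_comm b c] }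

/-! ### The family of generalized eigenvectors -/

/-- The set `Δ(a,b)` of pairs `(n,m)` of natural numbers with
`4 (b - a) = (4 m² - (2 n + 1)²) π²`. -/
def Delta (a b : ℝ) : Set (ℕ × ℕ) :=
  {p | 4 * (b - a) = (4 * (p.2 : ℝ) ^ 2 - (2 * (p.1 : ℝ) + 1) ^ 2) * Real.pi ^ 2}

/-- The set `Δ₂(a,b)` of all `m` such that `(n,m) ∈ Δ(a,b)` for some `n`. -/
def Delta₂ (a b : ℝ) : Set ℕ := {m | ∃ n : ℕ, (n, m) ∈ Delta a b}

/-- The integer `k` with `(k,m) ∈ Δ(a,b)` is unique. -/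
theorem Delta_unique {a b : ℝ} {k k' m : ℕ} (h : (k, m) ∈ Delta a b) (h' : (k', m) ∈ Delta a b) :
    k = k' := by
  have e := h.symm.trans h'
  have e2 := mul_right_cancel₀ (pow_ne_zero 2 Real.pi_ne_zero) e
  have e3 : (2 * (k : ℝ) + 1) ^ 2 = (2 * (k' : ℝ) + 1) ^ 2 := by simpa using e2
  have e4 := (pow_left_inj₀ (by positivity) (by positivity) two_ne_zero).mp e3
  have e5 : (k : ℝ) = k' := by linarith
  exact_mod_cast e5

/-- `λ_{1,n} = a - (n + 1/2)² π²`. -/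
def eig₁ (a : ℝ) (n : ℕ) : ℝ := a - ((n : ℝ) + 1 / 2) ^ 2 * Real.pi ^ 2

/-- `λ_{2,m} = b - m² π²`. -/
def eig₂ (b : ℝ) (m : ℕ) : ℝ := b - (m : ℝ) ^ 2 * Real.pi ^ 2

/-- The first component of `φ_{1,n}`. -/
def phi₁₁ (n : ℕ) (x : ℝ) : ℝ := √2 * Real.cos (((n : ℝ) + 1 / 2) * Real.pi * x)

/-- The second component of `φ_{2,m}`. -/
def phi₂₂ (m : ℕ) (x : ℝ) : ℝ := if m = 0 then 1 else √2 * Real.cos ((m : ℝ) * Real.pi * x)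

/-- `μ_m = φ_{2,m}²(0)`. -/
def muCoef (m : ℕ) : ℝ := phi₂₂ m 0

/-- A complex square root `r_m` of `λ_{2,m} - a`. -/
def rootR (a b : ℝ) (m : ℕ) : ℂ := ((eig₂ b m - a : ℝ) : ℂ) ^ (1 / 2 : ℂ)

open Classical in
/-- The first component of `φ_{2,m}`. In the last case the complex number is real and does not
depend on the choice of the square root, see `ofReal_phi₂₁`. -/
def phi₂₁ (a b s : ℝ) (m : ℕ) (x : ℝ) : ℝ :=
  if h : m ∈ Delta₂ a b then
    s * muCoef m / (((h.choose : ℕ) + 1 / 2 : ℝ) * Real.pi) *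
      ((1 - x) * Real.sin (((h.choose : ℕ) + 1 / 2 : ℝ) * Real.pi * x))
  else if b - a = (m : ℝ) ^ 2 * Real.pi ^ 2 then
    s * muCoef m * (-1 + x)
  else
    (-((s * muCoef m : ℝ) : ℂ) / (rootR a b m * Complex.cosh (rootR a b m)) *
      Complex.sinh (rootR a b m * (1 - (x : ℂ)))).re

theorem rootR_sq (a b : ℝ) (m : ℕ) : rootR a b m ^ 2 = ((eig₂ b m - a : ℝ) : ℂ) := by
  rw [rootR, ← Complex.cpow_nat_mul]
  norm_num

theorem ofReal_phi₂₁ {a b s : ℝ} {m : ℕ} (h : m ∉ Delta₂ a b)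
    (h' : b - a ≠ (m : ℝ) ^ 2 * Real.pi ^ 2) {r : ℂ} (hr : r ^ 2 = ((eig₂ b m - a : ℝ) : ℂ))
    (x : ℝ) :
    (phi₂₁ a b s m x : ℂ) =
      -((s * muCoef m : ℝ) : ℂ) / (r * Complex.cosh r) * Complex.sinh (r * (1 - (x : ℂ))) := by
  have indep : ∀ r₁ r₂ : ℂ, r₁ ^ 2 = r₂ ^ 2 → ∀ c : ℂ,
      c / (r₁ * Complex.cosh r₁) * Complex.sinh (r₁ * (1 - (x : ℂ))) =
      c / (r₂ * Complex.cosh r₂) * Complex.sinh (r₂ * (1 - (x : ℂ))) := by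
    intro r₁ r₂ hrr c
    rcases sq_eq_sq_iff_eq_or_eq_neg.mp hrr with rfl | rfl
    · rfl
    · rw [Complex.cosh_neg, neg_mul, neg_mul, Complex.sinh_neg, div_neg, neg_mul_neg]
  rw [phi₂₁, dif_neg h, if_neg h', indep _ r ((rootR_sq a b m).trans hr.symm)]
  have hconj : (starRingEnd ℂ r) ^ 2 = r ^ 2 := by
    rw [← map_pow, hr, Complex.conj_ofReal]
  apply Complex.conj_eq_iff_re.mp
  have key := indep _ r hconj (-((s * muCoef m : ℝ) : ℂ))
  rw [← key]
  simp only [map_mul, map_div₀, map_neg, Complex.conj_ofReal, ← Complex.cosh_conj,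
    ← Complex.sinh_conj, map_sub, map_one, Complex.conj_conj]
  exact key.symm

theorem continuous_phi₁₁ (n : ℕ) : Continuous (phi₁₁ n) := by
  unfold phi₁₁; fun_prop

theorem continuous_phi₂₂ (m : ℕ) : Continuous (phi₂₂ m) := by
  unfold phi₂₂; split_ifs <;> fun_prop

theorem continuous_phi₂₁ (a b s : ℝ) (m : ℕ) : Continuous (phi₂₁ a b s m) := by
  unfold phi₂₁
  split_ifs
  · fun_prop
  · fun_prop
  · exact Complex.continuous_re.comp (continuous_const.mul
      (Complex.continuous_sinh.comp (by fun_prop)))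

theorem memLp_of_continuous {f : ℝ → ℝ} (hf : Continuous f) : MemLp f 2 mu01 := by
  obtain ⟨C, hC⟩ := isCompact_Icc.exists_bound_of_continuousOn (s := Icc (0 : ℝ) 1)
    hf.continuousOn
  refine MemLp.of_bound hf.aestronglyMeasurable C ?_
  filter_upwards [ae_restrict_mem measurableSet_Ioo] with x hx
  exact hC x (Ioo_subset_Icc_self hx)

/-- The element of `L²(0,1)` given by a continuous function. -/
def toL2 (f : ℝ → ℝ) (hf : Continuous f) : L2 := (memLp_of_continuous hf).toLp f

/-- `φ_{1,n} = (φ_{1,n}¹, 0)`. -/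
def Phi₁ (n : ℕ) : H0 := WithLp.toLp 2 (toL2 (phi₁₁ n) (continuous_phi₁₁ n), 0)

/-- `φ_{2,m} = (φ_{2,m}¹, φ_{2,m}²)`. -/
def Phi₂ (a b s : ℝ) (m : ℕ) : H0 :=
  WithLp.toLp 2 (toL2 (phi₂₁ a b s m) (continuous_phi₂₁ a b s m),
    toL2 (phi₂₂ m) (continuous_phi₂₂ m))

/-- The family `Φ` of all `φ_{1,n}` and all `φ_{2,m}`. -/
def Phi (a b s : ℝ) : ℕ ⊕ ℕ → H0 := Sum.elim Phi₁ (Phi₂ a b s)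

/-- The eigenvalues `λ_{1,n}` and `λ_{2,m}`, indexed as `Phi`. -/
def eig (a b : ℝ) : ℕ ⊕ ℕ → ℝ := Sum.elim (eig₁ a) (eig₂ b)

/-! ### General notions -/

/-- A Riesz basis: the image of an orthonormal (Hilbert) basis under a bounded linear operator with
bounded inverse. -/
def IsRieszBasis {ι E : Type*} [NormedAddCommGroup E] [InnerProductSpace ℝ E] (v : ι → E) : Prop :=
  ∃ (e : HilbertBasis ι ℝ E) (T : E ≃L[ℝ] E), ∀ i, v i = T (e i)

/-- `u` is in the domain of `(A - lam)^k` and `(A - lam)^k u = 0`. -/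
def PowKills {E : Type*} [AddCommGroup E] [Module ℝ E] (A : E →ₗ.[ℝ] E) (lam : ℝ) : ℕ → E → Prop
  | 0, u => u = 0
  | k + 1, u => ∃ h : u ∈ A.domain, PowKills A lam k (A ⟨u, h⟩ - lam • u)

/-- `u` is a generalized eigenvector of `A` associated with `lam`. -/
def IsGeneralizedEigenvector {E : Type*} [AddCommGroup E] [Module ℝ E] (A : E →ₗ.[ℝ] E)
    (lam : ℝ) (u : E) : Prop :=
  u ≠ 0 ∧ ∃ k : ℕ, PowKills A lam k u

/-- A `C₀`-semigroup of bounded linear operators. -/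
structure C0Semigroup (E : Type*) [NormedAddCommGroup E] [NormedSpace ℝ E] where
  /-- The operator at time `t`. -/
  op : ℝ≥0 → E →L[ℝ] E
  op_zero : op 0 = ContinuousLinearMap.id ℝ E
  op_add : ∀ t t' : ℝ≥0, op (t + t') = (op t).comp (op t')
  strongly_continuous : ∀ u : E, Tendsto (fun t : ℝ≥0 => op t u) (𝓝[>] 0) (𝓝 u)

/-- `A` is the infinitesimal generator of the semigroup `S`: the limit of `(S(t)u - u)/t` as
`t → 0+` exists exactly for `u` in the domain of `A`, and then it is `A u`. -/
def C0Semigroup.IsGenerator {E : Type*} [NormedAddCommGroup E] [NormedSpace ℝ E]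
    (S : C0Semigroup E) (A : E →ₗ.[ℝ] E) : Prop :=
  ∀ u w : E, Tendsto (fun t : ℝ≥0 => (t : ℝ)⁻¹ • (S.op t u - u)) (𝓝[>] 0) (𝓝 w) ↔
    ∃ h : u ∈ A.domain, A ⟨u, h⟩ = w

/-- `A` generates a `C₀`-semigroup. -/
def GeneratesC0Semigroup {E : Type*} [NormedAddCommGroup E] [NormedSpace ℝ E]
    (A : E →ₗ.[ℝ] E) : Prop :=
  ∃ S : C0Semigroup E, S.IsGenerator A

end HeatCascade

end

/-!
Let `K` be the operator of `L²(0,1)` taking the cosines of integer frequency to the first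
components of the `φ_{2,m}`. These components decay like `1 / m`, so `K` is bounded, and the shear
`T (f, g) = (f + K g, g)` is an isomorphism taking the orthonormal basis of cosines (half-integer
frequencies in the first component, integer ones in the second) to `Φ`. Hence `Φ` is a Riesz basis.

In the cosine basis `T⁻¹ 𝒜 T` becomes `D + N`, with `D` diagonal and `N` bounded, of square zero and
commuting with `D`: the nonzero entries of `N` sit at the resonances `λ_{1,k} = λ_{2,m}`. So the
`φ_{1,n}` and `φ_{2,m}` are generalized eigenvectors, and `T (D + N) T⁻¹` generates the semigroup
`T exp(tD) (1 + tN) T⁻¹`. As `𝒜` is closed, it extends `T (D + N) T⁻¹`. The two are equal because,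
for `l` to the right of the spectrum, `l - (D + N)` is onto, while `l - 𝒜` is injective by an energy
identity for each component.

The cosines are complete because polynomials in `cos (π x)` are uniformly dense among the continuous
functions on `[0, 1]`.
-/

open scoped InnerProduct

noncomputable section

namespace HeatCascade

/-! ### `C₀`-semigroups and their generators -/

section Semigroup

variable {E F : Type*} [NormedAddCommGroup E] [NormedSpace ℝ E] [NormedAddCommGroup F]
  [NormedSpace ℝ F]

theorem tendsto_coe_nhdsGT_zero : Tendsto (fun t : ℝ≥0 => (t : ℝ)) (𝓝[>] 0) (𝓝[>] 0) := by
  refine tendsto_nhdsWithin_iff.mpr ⟨?_, ?_⟩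
  · exact (NNReal.continuous_coe.tendsto 0).mono_left nhdsWithin_le_nhds
  · filter_upwards [self_mem_nhdsWithin] with t ht
    exact ht

namespace C0Semigroup

/-- The generator of `S`, as a relation: `u` is in its domain and is mapped to `w`. -/
def HasGeneratorValue (S : C0Semigroup E) (u w : E) : Prop :=
  Tendsto (fun t : ℝ≥0 => (t : ℝ)⁻¹ • (S.op t u - u)) (𝓝[>] 0) (𝓝 w)

theorem isGenerator_iff {S : C0Semigroup E} {A : E →ₗ.[ℝ] E} :
    S.IsGenerator A ↔ ∀ u w, S.HasGeneratorValue u w ↔ (u, w) ∈ A.graph := by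
  simp only [IsGenerator, HasGeneratorValue, LinearPMap.mem_graph_iff, Subtype.exists,
    exists_and_left, exists_eq_left]

/-- The semigroup `T S(t) T⁻¹`. -/
def conj (S : C0Semigroup E) (T : E ≃L[ℝ] F) : C0Semigroup F where
  op t := (T : E →L[ℝ] F) ∘L S.op t ∘L (T.symm : F →L[ℝ] E)
  op_zero := by ext x; simp [S.op_zero]
  op_add t t' := by ext x; simp [S.op_add]
  strongly_continuous u := by
    have h := (T.continuous.tendsto _).comp (S.strongly_continuous (T.symm u))
    rwa [T.apply_symm_apply] at h

theorem hasGeneratorValue_conj_iff {S : C0Semigroup E} {T : E ≃L[ℝ] F} {u w : F} :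
    (S.conj T).HasGeneratorValue u w ↔ S.HasGeneratorValue (T.symm u) (T.symm w) := by
  unfold HasGeneratorValue
  rw [T.symm.toHomeomorph.isInducing.tendsto_nhds_iff]
  simp [Function.comp_def, conj]

/-- The semigroup `S(t)(1 + tN) = S(t) exp(tN)`, for `N` of square zero commuting with `S`. -/
def addNilpotent (S : C0Semigroup E) (N : E →L[ℝ] E) (hSN : ∀ t x, N (S.op t x) = S.op t (N x))
    (hN : ∀ x, N (N x) = 0) : C0Semigroup E where
  op t := S.op t ∘L (ContinuousLinearMap.id ℝ E + (t : ℝ) • N)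
  op_zero := by simp [S.op_zero]
  op_add t t' := by
    ext x
    simp only [S.op_add, NNReal.coe_add, add_smul, ContinuousLinearMap.comp_add,
      ContinuousLinearMap.comp_id, ContinuousLinearMap.comp_smulₛₗ, Real.ringHom_apply, add_apply,
      ContinuousLinearMap.comp_apply, smul_apply, ContinuousLinearMap.add_comp,
      ContinuousLinearMap.smul_comp, smul_add, hSN, hN, map_zero, smul_zero, add_zero]
    abel
  strongly_continuous u := by
    have h := (S.strongly_continuous u).add
      ((tendsto_coe_nhdsGT_zero.mono_right nhdsWithin_le_nhds).smul (S.strongly_continuous (N u)))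
    rw [zero_smul, add_zero] at h
    simpa using h

theorem hasGeneratorValue_addNilpotent_iff {S : C0Semigroup E} {N : E →L[ℝ] E}
    {hSN : ∀ t x, N (S.op t x) = S.op t (N x)} {hN : ∀ x, N (N x) = 0} {u w : E} :
    (S.addNilpotent N hSN hN).HasGeneratorValue u w ↔ S.HasGeneratorValue u (w - N u) := by
  have hquot : (fun t : ℝ≥0 => (t : ℝ)⁻¹ • ((S.addNilpotent N hSN hN).op t u - u)) =ᶠ[𝓝[>] 0]
      fun t => (t : ℝ)⁻¹ • (S.op t u - u) + S.op t (N u) := by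
    filter_upwards [self_mem_nhdsWithin] with t ht
    have ht' : (t : ℝ) ≠ 0 := (show (0 : ℝ) < t from ht).ne'
    simp only [addNilpotent, ContinuousLinearMap.comp_apply, add_apply,
      ContinuousLinearMap.id_apply, smul_apply, map_add, map_smul, smul_sub, smul_add,
      inv_smul_smul₀ ht']
    abel
  unfold HasGeneratorValue
  rw [tendsto_congr' hquot]
  constructor
  · intro h
    simpa using h.sub (S.strongly_continuous (N u))
  · intro h
    simpa using h.add (S.strongly_continuous (N u))

end C0Semigroup

end Semigroup

/-! ### Diagonal operators in a Hilbert basis -/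

section Diagonal

variable {ι E F : Type*} [NormedAddCommGroup E] [InnerProductSpace ℝ E]
  [NormedAddCommGroup F] [NormedSpace ℝ F] (e : HilbertBasis ι ℝ E)

theorem ext_inner_hilbertBasis {x y : E} (h : ∀ i, inner ℝ (e i) x = inner ℝ (e i) y) : x = y := by
  refine e.repr.injective (lp.ext (funext fun i => ?_))
  rw [e.repr_apply_apply, e.repr_apply_apply, h]

theorem inner_hilbertBasis [DecidableEq ι] (i j : ι) :
    inner ℝ (e i) (e j) = if i = j then 1 else 0 :=
  orthonormal_iff_ite.mp e.orthonormal i j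

theorem summable_inner_sq (x : E) : Summable fun i => (inner ℝ (e i) x) ^ 2 := by
  simpa [pow_two, real_inner_comm] using e.summable_inner_mul_inner x x

theorem norm_sq_eq_tsum_inner_sq (x : E) : ‖x‖ ^ 2 = ∑' i, (inner ℝ (e i) x) ^ 2 := by
  rw [← real_inner_self_eq_norm_sq, ← e.tsum_inner_mul_inner x x]
  simp [pow_two, real_inner_comm]

theorem norm_le_of_inner_eq_mul {m : ι → ℝ} {C : ℝ} (hC : 0 ≤ C) (hm : ∀ i, |m i| ≤ C) {x y : E}
    (h : ∀ i, inner ℝ (e i) y = m i * inner ℝ (e i) x) : ‖y‖ ≤ C * ‖x‖ := by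
  refine le_of_sq_le_sq ?_ (by positivity)
  rw [mul_pow, norm_sq_eq_tsum_inner_sq e y, norm_sq_eq_tsum_inner_sq e x, ← tsum_mul_left]
  refine (summable_inner_sq e y).tsum_le_tsum (fun i => ?_) ((summable_inner_sq e x).mul_left _)
  rw [h, mul_pow]
  exact mul_le_mul_of_nonneg_right (sq_le_sq' (abs_le.mp (hm i)).1 (abs_le.mp (hm i)).2)
    (sq_nonneg _)

/-- The vector with prescribed square-summable coordinates. -/
def ofCoords (d : ι → ℝ) (hd : Summable fun i => d i ^ 2) : E :=
  e.repr.symm ⟨d, memℓp_gen (by simpa using hd)⟩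

theorem inner_ofCoords {d : ι → ℝ} (hd : Summable fun i => d i ^ 2) (i : ι) :
    inner ℝ (e i) (ofCoords e d hd) = d i := by
  rw [ofCoords, ← e.repr_apply_apply, LinearIsometryEquiv.apply_symm_apply]

theorem summable_mul_inner_sq {m : ι → ℝ} {C : ℝ} (hm : ∀ i, |m i| ≤ C) (x : E) :
    Summable fun i => (m i * inner ℝ (e i) x) ^ 2 := by
  refine Summable.of_nonneg_of_le (fun i => sq_nonneg _) (fun i => ?_)
    ((summable_inner_sq e x).mul_left (C ^ 2))
  rw [mul_pow]
  exact mul_le_mul_of_nonneg_right (sq_le_sq' (abs_le.mp (hm i)).1 (abs_le.mp (hm i)).2)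
    (sq_nonneg _)

/-- The bounded operator multiplying the `i`-th coordinate by `m i`. -/
def diagOp {m : ι → ℝ} {C : ℝ} (hm : ∀ i, |m i| ≤ C) : E →L[ℝ] E :=
  LinearMap.mkContinuous
    { toFun := fun x => ofCoords e _ (summable_mul_inner_sq e hm x)
      map_add' := fun x y => ext_inner_hilbertBasis e fun i => by
        simp only [inner_ofCoords, inner_add_right, mul_add]
      map_smul' := fun c x => ext_inner_hilbertBasis e fun i => by
        simp only [inner_ofCoords, inner_smul_right, RingHom.id_apply, mul_left_comm] } |C|
    fun x => norm_le_of_inner_eq_mul e (abs_nonneg C) (fun i => (hm i).trans (le_abs_self C))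
      (inner_ofCoords e (summable_mul_inner_sq e hm x))

theorem inner_diagOp {m : ι → ℝ} {C : ℝ} (hm : ∀ i, |m i| ≤ C) (x : E) (i : ι) :
    inner ℝ (e i) (diagOp e hm x) = m i * inner ℝ (e i) x :=
  inner_ofCoords e (summable_mul_inner_sq e hm x) i

theorem tendsto_of_inner_eq_mul {α : Type*} {l : Filter α} {m : α → ι → ℝ} {C : ℝ}
    (hb : ∀ᶠ t in l, ∀ i, |m t i| ≤ C) (hm : ∀ i, Tendsto (fun t => m t i) l (𝓝 1)) {z : E}
    {y : α → E} (hy : ∀ᶠ t in l, ∀ i, inner ℝ (e i) (y t) = m t i * inner ℝ (e i) z) :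
    Tendsto y l (𝓝 z) := by
  have hsq : Tendsto (fun t => ∑' i, ((m t i - 1) * inner ℝ (e i) z) ^ 2) l
      (𝓝 (∑' _ : ι, (0 : ℝ))) := by
    refine tendsto_tsum_of_dominated_convergence
      ((summable_inner_sq e z).mul_left ((C + 1) ^ 2)) (fun i => ?_) ?_
    · simpa using (((hm i).sub_const 1).mul_const (inner ℝ (e i) z)).pow 2
    · filter_upwards [hb] with t ht i
      have := abs_le.mp (ht i)
      rw [Real.norm_of_nonneg (sq_nonneg _), mul_pow]
      exact mul_le_mul_of_nonneg_right (sq_le_sq' (by linarith) (by linarith)) (sq_nonneg _)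
  have hnorm : ∀ᶠ t in l, √(∑' i, ((m t i - 1) * inner ℝ (e i) z) ^ 2) = ‖y t - z‖ := by
    filter_upwards [hy] with t ht
    rw [← Real.sqrt_sq (norm_nonneg (y t - z)), norm_sq_eq_tsum_inner_sq e]
    simp only [inner_sub_right, ht, sub_one_mul]
  rw [tendsto_iff_norm_sub_tendsto_zero]
  simpa using hsq.sqrt.congr' hnorm

theorem summable_norm_inner_smul {w : ι → F} (hw : Summable fun i => ‖w i‖ ^ 2) (x : E) :
    Summable fun i => ‖inner ℝ (e i) x • w i‖ := by
  refine Summable.of_nonneg_of_le (fun i => norm_nonneg _) (fun i => ?_)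
    ((summable_inner_sq e x).add hw)
  rw [norm_smul, ← sq_abs, Real.norm_eq_abs]
  nlinarith [sq_nonneg (|inner ℝ (e i) x| - ‖w i‖), sq_nonneg (|inner ℝ (e i) x| + ‖w i‖)]

theorem norm_tsum_inner_smul_le {w : ι → F} (hw : Summable fun i => ‖w i‖ ^ 2) (x : E) :
    ‖∑' i, inner ℝ (e i) x • w i‖ ≤ √(∑' i, ‖w i‖ ^ 2) * ‖x‖ := by
  refine (norm_tsum_le_tsum_norm (summable_norm_inner_smul e hw x)).trans ?_
  refine Real.tsum_le_of_sum_le (fun i => norm_nonneg _) fun s => ?_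
  calc ∑ i ∈ s, ‖inner ℝ (e i) x • w i‖
      ≤ √(∑ i ∈ s, ‖inner ℝ (e i) x‖ ^ 2) * √(∑ i ∈ s, ‖w i‖ ^ 2) := by
        simp_rw [norm_smul]
        exact Real.sum_mul_le_sqrt_mul_sqrt s _ _
    _ ≤ √(∑' i, (inner ℝ (e i) x) ^ 2) * √(∑' i, ‖w i‖ ^ 2) := by
        simp_rw [Real.norm_eq_abs, sq_abs]
        gcongr
        · exact (summable_inner_sq e x).sum_le_tsum s fun i _ => sq_nonneg _
        · exact hw.sum_le_tsum s fun i _ => sq_nonneg _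
    _ = √(∑' i, ‖w i‖ ^ 2) * ‖x‖ := by
        rw [← norm_sq_eq_tsum_inner_sq, Real.sqrt_sq (norm_nonneg x), mul_comm]

/-- The bounded operator mapping the basis vectors `e i` to the terms `w i` of a square-summable
family. -/
def synthesisOp [CompleteSpace F] {w : ι → F} (hw : Summable fun i => ‖w i‖ ^ 2) : E →L[ℝ] F :=
  LinearMap.mkContinuous
    { toFun := fun x => ∑' i, inner ℝ (e i) x • w i
      map_add' := fun x y => by
        rw [← (summable_norm_inner_smul e hw x).of_norm.tsum_add
          (summable_norm_inner_smul e hw y).of_norm]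
        simp_rw [inner_add_right, add_smul]
      map_smul' := fun c x => by
        rw [RingHom.id_apply, ← (summable_norm_inner_smul e hw x).of_norm.tsum_const_smul]
        simp_rw [inner_smul_right, mul_smul] }
    (√(∑' i, ‖w i‖ ^ 2)) (norm_tsum_inner_smul_le e hw)

theorem synthesisOp_apply_basis [CompleteSpace F] {w : ι → F} (hw : Summable fun i => ‖w i‖ ^ 2)
    (j : ι) : synthesisOp e hw (e j) = w j := by
  classical
  change ∑' i, inner ℝ (e i) (e j) • w i = w j
  simp [inner_hilbertBasis, tsum_ite_eq]

end Diagonal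

/-! ### Diagonal semigroups -/

section DiagSemigroup

variable {ι E : Type*} [NormedAddCommGroup E] [InnerProductSpace ℝ E] (e : HilbertBasis ι ℝ E)

theorem eventually_le_one_nhdsGT_zero : ∀ᶠ t : ℝ≥0 in 𝓝[>] 0, t ≤ 1 :=
  nhdsWithin_le_nhds (Iic_mem_nhds zero_lt_one)

theorem abs_exp_mul_le {l om : ℝ} (h : l ≤ om) (t : ℝ≥0) :
    |Real.exp (l * t)| ≤ Real.exp (om * t) := by
  rw [Real.abs_exp]
  gcongr

theorem abs_exp_mul_le_of_le_one {l om : ℝ} (h : l ≤ om) {t : ℝ≥0} (ht : t ≤ 1) :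
    |Real.exp (l * t)| ≤ Real.exp |om| := by
  refine (abs_exp_mul_le h t).trans (Real.exp_le_exp.mpr ?_)
  nlinarith [show (t : ℝ) ≤ 1 from ht, le_abs_self om, abs_nonneg om, t.2]

theorem abs_dslope_exp_zero_le {x y : ℝ} (hy : 0 ≤ y) (h : x ≤ y) :
    |dslope Real.exp 0 x| ≤ Real.exp y := by
  rcases eq_or_ne x 0 with rfl | hx
  · simpa using hy
  rw [dslope_of_ne _ hx, slope_def_field, sub_zero, Real.exp_zero, abs_div,
    div_le_iff₀ (abs_pos.mpr hx)]
  have hexp := Real.add_one_le_exp x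
  have hexp_neg : Real.exp x - 1 ≤ x * Real.exp x := by
    have := mul_le_mul_of_nonneg_right (Real.add_one_le_exp (-x)) (Real.exp_pos x).le
    rw [← Real.exp_add, neg_add_cancel, Real.exp_zero] at this
    linarith
  have hxy := Real.exp_le_exp.mpr h
  have hy1 := Real.one_le_exp hy
  rcases lt_or_gt_of_ne hx with hneg | hpos
  · rw [abs_of_neg hneg, abs_of_neg (by linarith [Real.exp_lt_one_iff.mpr hneg])]
    nlinarith
  · rw [abs_of_pos hpos, abs_of_pos (by linarith)]
    nlinarith

theorem tendsto_dslope_exp_zero (l : ℝ) :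
    Tendsto (fun t : ℝ≥0 => dslope Real.exp 0 (l * t)) (𝓝[>] 0) (𝓝 1) := by
  have hcont : ContinuousAt (dslope Real.exp 0) (l * 0) := by
    rw [mul_zero]
    exact continuousAt_dslope_same.mpr Real.differentiableAt_exp
  have hmul : Tendsto (fun t : ℝ≥0 => l * (t : ℝ)) (𝓝[>] 0) (𝓝 (l * 0)) :=
    (tendsto_coe_nhdsGT_zero.mono_right nhdsWithin_le_nhds).const_mul l
  simpa [Function.comp_def] using hcont.tendsto.comp hmul

theorem exp_mul_sub_one (l t : ℝ) :
    Real.exp (l * t) - 1 = t * (l * dslope Real.exp 0 (l * t)) := by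
  have := sub_smul_dslope Real.exp 0 (l * t)
  rw [sub_zero, smul_eq_mul, Real.exp_zero] at this
  linarith

/-- The semigroup multiplying the `i`-th coordinate by `exp (lam i * t)`. -/
def diagSemigroup {lam : ι → ℝ} {om : ℝ} (h : ∀ i, lam i ≤ om) : C0Semigroup E where
  op t := diagOp e fun i => abs_exp_mul_le (h i) t
  op_zero := by
    ext x
    refine ext_inner_hilbertBasis e fun i => ?_
    simp [inner_diagOp]
  op_add t t' := by
    ext x
    refine ext_inner_hilbertBasis e fun i => ?_
    simp [inner_diagOp, mul_add, Real.exp_add, mul_assoc]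
  strongly_continuous u := by
    refine tendsto_of_inner_eq_mul e (C := Real.exp |om|) ?_ (fun i => ?_)
      (Eventually.of_forall fun t => inner_diagOp e (fun i => abs_exp_mul_le (h i) t) u)
    · filter_upwards [eventually_le_one_nhdsGT_zero] with t ht i
      exact abs_exp_mul_le_of_le_one (h i) ht
    · have : Continuous fun t : ℝ≥0 => Real.exp (lam i * t) := by fun_prop
      simpa using (this.tendsto 0).mono_left nhdsWithin_le_nhds

theorem inner_diagSemigroup {lam : ι → ℝ} {om : ℝ} (h : ∀ i, lam i ≤ om) (t : ℝ≥0) (x : E)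
    (i : ι) : inner ℝ (e i) ((diagSemigroup e h).op t x) = Real.exp (lam i * t) * inner ℝ (e i) x :=
  inner_diagOp e (fun i => abs_exp_mul_le (h i) t) x i

theorem inner_quotient_diagSemigroup {lam : ι → ℝ} {om : ℝ} (h : ∀ i, lam i ≤ om) {t : ℝ≥0}
    (ht : (t : ℝ) ≠ 0) (x : E) (i : ι) :
    inner ℝ (e i) ((t : ℝ)⁻¹ • ((diagSemigroup e h).op t x - x)) =
      dslope Real.exp 0 (lam i * t) * (lam i * inner ℝ (e i) x) := by
  rw [inner_smul_right, inner_sub_right, inner_diagSemigroup, ← sub_one_mul, exp_mul_sub_one]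
  field_simp

theorem hasGeneratorValue_diagSemigroup_iff {lam : ι → ℝ} {om : ℝ} (h : ∀ i, lam i ≤ om)
    {x z : E} : (diagSemigroup e h).HasGeneratorValue x z ↔
      ∀ i, lam i * inner ℝ (e i) x = inner ℝ (e i) z := by
  have hquot : ∀ᶠ t : ℝ≥0 in 𝓝[>] 0, ∀ i,
      inner ℝ (e i) ((t : ℝ)⁻¹ • ((diagSemigroup e h).op t x - x)) =
        dslope Real.exp 0 (lam i * t) * (lam i * inner ℝ (e i) x) := by
    filter_upwards [self_mem_nhdsWithin] with t ht
    exact inner_quotient_diagSemigroup e h (show (0 : ℝ) < t from ht).ne' x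
  constructor
  · intro hz i
    have hlim := (tendsto_dslope_exp_zero (lam i)).mul_const (lam i * inner ℝ (e i) x)
    rw [one_mul] at hlim
    exact tendsto_nhds_unique hlim
      ((tendsto_const_nhds.inner hz).congr' (hquot.mono fun t ht => ht i))
  · intro hz
    refine tendsto_of_inner_eq_mul e (C := Real.exp |om|) ?_
      (fun i => tendsto_dslope_exp_zero (lam i)) (by simpa only [hz] using hquot)
    filter_upwards [eventually_le_one_nhdsGT_zero] with t ht i
    refine abs_dslope_exp_zero_le (abs_nonneg om) ?_
    nlinarith [show (t : ℝ) ≤ 1 from ht, h i, le_abs_self om, abs_nonneg om, t.2,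
      mul_le_mul_of_nonneg_right (h i) t.2]

end DiagSemigroup

/-! ### Operators that are diagonal up to a commuting nilpotent part in a Riesz basis -/

section Jordan

variable {ι E F : Type*} [NormedAddCommGroup E] [InnerProductSpace ℝ E] [NormedAddCommGroup F]
  [NormedSpace ℝ F] {e : HilbertBasis ι ℝ E} {lam : ι → ℝ} {N : E →L[ℝ] E}

theorem ext_hilbertBasis (e : HilbertBasis ι ℝ E) {S S' : E →L[ℝ] F} (h : ∀ i, S (e i) = S' (e i)) :
    S = S' := by
  refine ContinuousLinearMap.ext_on (s := range e) ?_ ?_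
  · rw [dense_iff_closure_eq, ← Submodule.topologicalClosure_coe, e.dense_span, Submodule.top_coe]
  · rintro _ ⟨i, rfl⟩
    exact h i

theorem diagOp_comm {m : ι → ℝ} {C : ℝ} (hm : ∀ i, |m i| ≤ C)
    (hN : ∀ i j, m j ≠ m i → inner ℝ (e j) (N (e i)) = 0) (x : E) :
    N (diagOp e hm x) = diagOp e hm (N x) := by
  classical
  have hcomp : N ∘L diagOp e hm = diagOp e hm ∘L N := by
    refine ext_hilbertBasis e fun i => ?_
    have hi : diagOp e hm (e i) = m i • e i := ext_inner_hilbertBasis e fun j => by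
      rw [inner_diagOp, inner_smul_right, inner_hilbertBasis]
      split_ifs with hji
      · rw [hji]
      · simp
    refine ext_inner_hilbertBasis e fun j => ?_
    rw [ContinuousLinearMap.comp_apply, ContinuousLinearMap.comp_apply, hi, map_smul,
      inner_smul_right, inner_diagOp]
    by_cases hji : m j = m i
    · rw [hji]
    · rw [hN i j hji, mul_zero, mul_zero]
  exact DFunLike.congr_fun hcomp x

/-- The graph of `T (D + N) T⁻¹`, where `D` is the unbounded diagonal operator with entries `lam` in
the Hilbert basis `e`. -/
def jordanGraph (e : HilbertBasis ι ℝ E) (lam : ι → ℝ) (N : E →L[ℝ] E) (T : E ≃L[ℝ] F) :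
    Submodule ℝ (F × F) where
  carrier := {p | ∀ i, lam i * inner ℝ (e i) (T.symm p.1) =
    inner ℝ (e i) (T.symm p.2 - N (T.symm p.1))}
  zero_mem' i := by simp
  add_mem' {p q} hp hq i := by
    have hp := hp i
    have hq := hq i
    simp only [Prod.fst_add, Prod.snd_add, map_add, inner_add_right, inner_sub_right] at *
    linarith
  smul_mem' c p hp i := by
    have hp := hp i
    simp only [Prod.smul_fst, Prod.smul_snd, map_smul, inner_smul_right, inner_sub_right] at *
    linear_combination c * hp

theorem mem_jordanGraph {T : E ≃L[ℝ] F} {u w : F} : (u, w) ∈ jordanGraph e lam N T ↔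
    ∀ i, lam i * inner ℝ (e i) (T.symm u) = inner ℝ (e i) (T.symm w - N (T.symm u)) :=
  Iff.rfl

theorem jordanGraph_le {T : E ≃L[ℝ] F} {G : Submodule ℝ (F × F)} (hG : IsClosed (G : Set (F × F)))
    (h : ∀ i, (T (e i), T (lam i • e i + N (e i))) ∈ G) : jordanGraph e lam N T ≤ G := by
  rintro ⟨u, w⟩ huw
  rw [mem_jordanGraph] at huw
  have hv := e.hasSum_repr (T.symm u)
  have hz := e.hasSum_repr (T.symm w - N (T.symm u))
  have hsum := (hv.mapL (T : E →L[ℝ] F)).prodMk ((hz.add (hv.mapL N)).mapL (T : E →L[ℝ] F))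
  simp only [ContinuousLinearEquiv.coe_coe, sub_add_cancel,
    ContinuousLinearEquiv.apply_symm_apply] at hsum
  refine hG.mem_of_tendsto hsum (Eventually.of_forall fun s => Submodule.sum_mem _ fun i _ => ?_)
  convert G.smul_mem (inner ℝ (e i) (T.symm u)) (h i) using 1
  simp only [Prod.smul_mk, e.repr_apply_apply, ← huw i, map_add, map_smul, smul_add, smul_smul,
    mul_comm]

theorem exists_mem_jordanGraph (hN : ∀ i j, lam j ≠ lam i → inner ℝ (e j) (N (e i)) = 0)
    (hNN : ∀ x, N (N x) = 0) {om l₀ : ℝ} (hlam : ∀ i, lam i ≤ om) (hl₀ : om < l₀) (T : E ≃L[ℝ] F)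
    (y : F) : ∃ u, (u, l₀ • u - y) ∈ jordanGraph e lam N T := by
  have hpos : ∀ i, 0 < l₀ - lam i := fun i => by linarith [hlam i]
  have hbound : ∀ i, |(l₀ - lam i)⁻¹| ≤ (l₀ - om)⁻¹ := fun i => by
    rw [abs_of_pos (inv_pos.mpr (hpos i))]
    exact inv_anti₀ (by linarith) (by linarith [hlam i])
  set R := diagOp e hbound
  have hNR : ∀ x, N (R x) = R (N x) := diagOp_comm hbound fun i j hij => hN i j (by grind)
  have hR : ∀ i x, inner ℝ (e i) (R x) = (l₀ - lam i)⁻¹ * inner ℝ (e i) x :=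
    fun i x => inner_diagOp e hbound x i
  set x := T.symm y with hx
  -- The Neumann series of `(l₀ - D - N)⁻¹` stops after two terms.
  refine ⟨T (R x + R (N (R x))), mem_jordanGraph.mpr fun i => ?_⟩
  have hNv : N (R x + R (N (R x))) = N (R x) := by rw [map_add, hNR (N (R x)), hNN]; simp
  simp only [map_sub, map_smul, T.symm_apply_apply, ← hx, hNv, inner_sub_right, inner_smul_right,
    inner_add_right, hR]
  have := (hpos i).ne'
  field_simp
  ring

theorem submodule_eq_of_surjective_of_injective {V : Type*} [AddCommGroup V] [Module ℝ V]
    {G H : Submodule ℝ (V × V)} (hGH : G ≤ H) {l : ℝ} (hsurj : ∀ y, ∃ u, (u, l • u - y) ∈ G)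
    (hinj : ∀ u, (u, l • u) ∈ H → u = 0) : G = H := by
  refine le_antisymm hGH ?_
  rintro ⟨u, w⟩ huw
  obtain ⟨v, hv⟩ := hsurj (l • u - w)
  have hdiff := H.sub_mem huw (hGH hv)
  rw [Prod.mk_sub_mk, show w - (l • v - (l • u - w)) = l • (u - v) by rw [smul_sub]; abel] at hdiff
  rw [sub_eq_zero.mp (hinj _ hdiff)] at hv ⊢
  simpa [sub_eq_zero.mp (hinj _ hdiff)] using hv

theorem generatesC0Semigroup_of_graph_eq_jordanGraph
    (hN : ∀ i j, lam j ≠ lam i → inner ℝ (e j) (N (e i)) = 0) (hNN : ∀ x, N (N x) = 0) {om : ℝ}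
    (hlam : ∀ i, lam i ≤ om) {T : E ≃L[ℝ] F} {A : F →ₗ.[ℝ] F}
    (hA : A.graph = jordanGraph e lam N T) : GeneratesC0Semigroup A := by
  have hcomm : ∀ t x, N ((diagSemigroup e hlam).op t x) = (diagSemigroup e hlam).op t (N x) :=
    fun t => diagOp_comm (fun i => abs_exp_mul_le (hlam i) t) fun i j hij => hN i j (by grind)
  refine ⟨((diagSemigroup e hlam).addNilpotent N hcomm hNN).conj T,
    C0Semigroup.isGenerator_iff.mpr fun u w => ?_⟩
  rw [C0Semigroup.hasGeneratorValue_conj_iff, C0Semigroup.hasGeneratorValue_addNilpotent_iff,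
    hasGeneratorValue_diagSemigroup_iff, hA, mem_jordanGraph]

theorem powKills_succ_iff {V : Type*} [AddCommGroup V] [Module ℝ V] {A : V →ₗ.[ℝ] V} {l : ℝ}
    {k : ℕ} {u : V} :
    PowKills A l (k + 1) u ↔ ∃ w, (u, w) ∈ A.graph ∧ PowKills A l k (w - l • u) := by
  simp [PowKills, LinearPMap.mem_graph_iff]

theorem isGeneralizedEigenvector_of_jordanGraph_le
    (hN : ∀ i j, lam j ≠ lam i → inner ℝ (e j) (N (e i)) = 0) (hNN : ∀ x, N (N x) = 0)
    {T : E ≃L[ℝ] F} {A : F →ₗ.[ℝ] F} (hA : jordanGraph e lam N T ≤ A.graph) (i : ι) :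
    IsGeneralizedEigenvector A (lam i) (T (e i)) := by
  classical
  refine ⟨by simpa using e.orthonormal.ne_zero i, 2, powKills_succ_iff.mpr
    ⟨T (lam i • e i + N (e i)), hA <| mem_jordanGraph.mpr fun j => ?_, powKills_succ_iff.mpr
      ⟨lam i • T (N (e i)), hA <| mem_jordanGraph.mpr fun j => ?_, ?_⟩⟩⟩
  · simp only [T.symm_apply_apply, add_sub_cancel_right, inner_smul_right, inner_hilbertBasis]
    split_ifs with hji
    · rw [hji]
    · simp
  · simp only [map_add, map_smul, add_sub_cancel_left, T.symm_apply_apply, hNN, sub_zero,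
      inner_smul_right]
    by_cases hji : lam j = lam i
    · rw [hji]
    · rw [hN i j hji, mul_zero, mul_zero]
  · simp [PowKills]

end Jordan

/-! ### Primitives and weak derivatives in `L²(0,1)` -/

section Sobolev

instance : IsProbabilityMeasure mu01 := ⟨by simp⟩

theorem integrable_L2 (h : L2) : Integrable h mu01 := (Lp.memLp h).integrable (by norm_num)

theorem intervalIntegral_zero_one (F : ℝ → ℝ) :
    ∫ x in (0 : ℝ)..1, F x = ∫ x in Ioo (0 : ℝ) 1, F x := by
  rw [intervalIntegral.integral_of_le zero_le_one, integral_Ioc_eq_integral_Ioo]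

theorem coeFn_toL2 {F : ℝ → ℝ} (hF : Continuous F) : toL2 F hF =ᵐ[mu01] F :=
  MemLp.coeFn_toLp _

theorem toL2_eq {F : ℝ → ℝ} (hF : Continuous F) {h : L2} (hh : h =ᵐ[mu01] F) : h = toL2 F hF :=
  Lp.ext (hh.trans (coeFn_toL2 hF).symm)

theorem toL2_congr {F G : ℝ → ℝ} (hF : Continuous F) (hG : Continuous G)
    (h : EqOn F G (Ioo 0 1)) : toL2 F hF = toL2 G hG :=
  toL2_eq hG ((coeFn_toL2 hF).trans ((ae_restrict_mem measurableSet_Ioo).mono h))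

theorem toL2_add {F G : ℝ → ℝ} (hF : Continuous F) (hG : Continuous G) :
    toL2 F hF + toL2 G hG = toL2 (fun x => F x + G x) (hF.add hG) :=
  toL2_eq _ ((Lp.coeFn_add _ _).trans ((coeFn_toL2 hF).add (coeFn_toL2 hG)))

theorem toL2_smul (c : ℝ) {F : ℝ → ℝ} (hF : Continuous F) :
    c • toL2 F hF = toL2 (fun x => c * F x) (continuous_const.mul hF) :=
  toL2_eq _ ((Lp.coeFn_smul _ _).trans ((coeFn_toL2 hF).const_smul c))

theorem inner_toL2 {F : ℝ → ℝ} (hF : Continuous F) (h : L2) :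
    inner ℝ (toL2 F hF) h = ∫ x in Ioo (0 : ℝ) 1, F x * h x := by
  rw [L2.inner_def]
  refine integral_congr_ae ?_
  filter_upwards [coeFn_toL2 hF] with x hx
  simp [hx, mul_comm]

theorem inner_toL2_toL2 {F G : ℝ → ℝ} (hF : Continuous F) (hG : Continuous G) :
    inner ℝ (toL2 F hF) (toL2 G hG) = ∫ x in (0 : ℝ)..1, F x * G x := by
  rw [inner_toL2, intervalIntegral_zero_one]
  refine integral_congr_ae ?_
  filter_upwards [coeFn_toL2 hG] with x hx
  rw [hx]

theorem norm_toL2_le {F : ℝ → ℝ} (hF : Continuous F) {C : ℝ} (hC : 0 ≤ C)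
    (h : ∀ x ∈ Ioo (0 : ℝ) 1, |F x| ≤ C) : ‖toL2 F hF‖ ≤ C := by
  have hbound : ∀ᵐ x ∂mu01, ‖toL2 F hF x‖ ≤ C := by
    filter_upwards [coeFn_toL2 hF, ae_restrict_mem measurableSet_Ioo] with x hx hx01
    rw [hx]
    exact h x hx01
  simpa [measureUnivNNReal] using Lp.norm_le_of_ae_bound hC hbound

/-- The constant function `1`. -/
def one : L2 := toL2 (fun _ => 1) continuous_const

theorem inner_one (h : L2) : inner ℝ one h = ∫ x in Ioo (0 : ℝ) 1, h x := by
  simp [one, inner_toL2]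

theorem inner_one_one : inner ℝ one one = 1 := by
  rw [one, inner_toL2_toL2]
  simp

/-- The primitive of `h` that vanishes at `0`, with `h` extended by `0` outside `(0,1)`. -/
def prim (h : L2) (x : ℝ) : ℝ := ∫ y in (0 : ℝ)..x, (Ioo (0 : ℝ) 1).indicator h y

theorem integrable_indicator_L2 (h : L2) : Integrable ((Ioo (0 : ℝ) 1).indicator h) :=
  (integrable_indicator_iff measurableSet_Ioo).mpr (integrable_L2 h)

theorem continuous_prim (h : L2) : Continuous (prim h) :=
  (integrable_indicator_L2 h).continuous_primitive 0

theorem prim_zero (h : L2) : prim h 0 = 0 := intervalIntegral.integral_same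

theorem prim_one (h : L2) : prim h 1 = inner ℝ one h := by
  rw [prim, intervalIntegral_zero_one, inner_one]
  exact setIntegral_congr_fun measurableSet_Ioo fun x hx => indicator_of_mem hx _

theorem prim_congr {h : L2} {F : ℝ → ℝ} (hF : h =ᵐ[mu01] F) (x : ℝ) :
    prim h x = ∫ y in (0 : ℝ)..x, (Ioo (0 : ℝ) 1).indicator F y := by
  refine intervalIntegral.integral_congr_ae ?_
  filter_upwards [(ae_restrict_iff' measurableSet_Ioo).mp hF] with y hy _
  by_cases hy01 : y ∈ Ioo (0 : ℝ) 1 <;> simp [hy01, hy]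

theorem prim_add (h k : L2) (x : ℝ) : prim (h + k) x = prim h x + prim k x := by
  rw [prim_congr (Lp.coeFn_add h k), indicator_add', prim, prim]
  exact intervalIntegral.integral_add (integrable_indicator_L2 h).intervalIntegrable
    (integrable_indicator_L2 k).intervalIntegrable

theorem prim_smul (c : ℝ) (h : L2) (x : ℝ) : prim (c • h) x = c * prim h x := by
  rw [prim_congr (Lp.coeFn_smul c h), prim, ← intervalIntegral.integral_const_mul]
  refine intervalIntegral.integral_congr fun y _ => ?_
  exact indicator_const_smul_apply _ c h y

theorem abs_prim_le (h : L2) (x : ℝ) : |prim h x| ≤ ‖h‖ := by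
  calc ‖prim h x‖ ≤ ∫ y in uIoc 0 x, ‖(Ioo (0 : ℝ) 1).indicator h y‖ :=
        intervalIntegral.norm_integral_le_integral_norm_uIoc
    _ ≤ ∫ y, ‖(Ioo (0 : ℝ) 1).indicator h y‖ :=
        setIntegral_le_integral (integrable_indicator_L2 h).norm
          (Eventually.of_forall fun y => norm_nonneg _)
    _ = (eLpNorm h 1 mu01).toReal := by
        simp_rw [norm_indicator_eq_indicator_norm]
        rw [integral_indicator measurableSet_Ioo, eLpNorm_one_eq_lintegral_enorm,
          integral_norm_eq_lintegral_enorm (Lp.aestronglyMeasurable h)]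
    _ ≤ ‖h‖ := by
        rw [Lp.norm_def]
        exact ENNReal.toReal_mono (Lp.eLpNorm_ne_top h)
          (eLpNorm_le_eLpNorm_of_exponent_le (by norm_num) (Lp.aestronglyMeasurable h))

/-- The Volterra operator, mapping `h` to its primitive that vanishes at `0`. -/
def volterra : L2 →L[ℝ] L2 :=
  LinearMap.mkContinuous
    { toFun := fun h => toL2 (prim h) (continuous_prim h)
      map_add' := fun h k => by
        rw [toL2_add]
        exact toL2_congr _ _ fun x _ => prim_add h k x
      map_smul' := fun c h => by
        rw [RingHom.id_apply, toL2_smul]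
        exact toL2_congr _ _ fun x _ => prim_smul c h x }
    1 fun h => by
      rw [one_mul]
      exact norm_toL2_le (continuous_prim h) (norm_nonneg h) fun x _ => abs_prim_le h x

theorem volterra_apply (h : L2) : volterra h = toL2 (prim h) (continuous_prim h) := rfl

theorem continuous_const_add_prim (c : ℝ) (h : L2) : Continuous fun x => c + prim h x :=
  continuous_const.add (continuous_prim h)

theorem const_add_volterra (c : ℝ) (h : L2) : c • one + volterra h =
    toL2 (fun x => c + prim h x) (continuous_const_add_prim c h) := by
  rw [volterra_apply, one, toL2_smul, toL2_add]
  exact toL2_congr _ _ fun x _ => by rw [mul_one]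

theorem toL2_eq_const_add_volterra {F F' : ℝ → ℝ} (hF : Continuous F) (hF' : Continuous F')
    (h : ∀ x, HasDerivAt F (F' x) x) : toL2 F hF = F 0 • one + volterra (toL2 F' hF') := by
  rw [const_add_volterra]
  refine toL2_congr _ _ fun x hx => ?_
  have hind : ∫ y in (0 : ℝ)..x, (Ioo (0 : ℝ) 1).indicator F' y = ∫ y in (0 : ℝ)..x, F' y := by
    refine intervalIntegral.integral_congr_ae (Eventually.of_forall fun y hy => ?_)
    rw [uIoc_of_le hx.1.le] at hy
    exact indicator_of_mem (show y ∈ Ioo (0 : ℝ) 1 from ⟨hy.1, hy.2.trans_lt hx.2⟩) _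
  rw [prim_congr (coeFn_toL2 hF'), hind,
    intervalIntegral.integral_eq_sub_of_hasDerivAt (fun x _ => h x) (hF'.intervalIntegrable _ _)]
  ring

theorem absolutelyContinuousOnInterval_prim (h : L2) :
    AbsolutelyContinuousOnInterval (prim h) 0 1 :=
  (integrable_indicator_L2 h).intervalIntegrable.absolutelyContinuousOnInterval_intervalIntegral
    (by simp)

theorem deriv_prim_ae_eq (h : L2) : deriv (prim h) =ᵐ[mu01] h := by
  have hi : IntervalIntegrable ((Ioo (0 : ℝ) 1).indicator h) volume 0 1 :=
    (integrable_indicator_L2 h).intervalIntegrable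
  refine (ae_restrict_iff' measurableSet_Ioo).mpr ?_
  filter_upwards [hi.ae_hasDerivAt_integral] with x hx hx01
  have hderiv : HasDerivAt (prim h) _ x :=
    hx (uIcc_of_le (zero_le_one (α := ℝ)) ▸ Ioo_subset_Icc_self hx01) 0 (by simp)
  rw [hderiv.deriv, indicator_of_mem hx01]

/-- Integration by parts: the Volterra operator plus its adjoint is the projection onto the
constants. -/
theorem inner_volterra_add_inner_volterra (h k : L2) :
    inner ℝ h (volterra k) + inner ℝ (volterra h) k = inner ℝ one h * inner ℝ one k := by
  have hparts := (absolutelyContinuousOnInterval_prim h).integral_deriv_mul_eq_sub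
    (absolutelyContinuousOnInterval_prim k)
  rw [prim_zero, prim_one, prim_one, zero_mul, sub_zero, intervalIntegral_zero_one] at hparts
  rw [← hparts, L2.inner_def, L2.inner_def,
    ← integral_add (L2.integrable_inner _ _) (L2.integrable_inner _ _)]
  refine integral_congr_ae ?_
  filter_upwards [deriv_prim_ae_eq h, deriv_prim_ae_eq k, coeFn_toL2 (continuous_prim h),
    coeFn_toL2 (continuous_prim k)] with x hh hk hVh hVk
  rw [hh, hk, volterra_apply, volterra_apply, hVh, hVk]
  simp [mul_comm]

theorem adjoint_volterra_apply (k : L2) :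
    (volterra†) k = inner ℝ one k • one - volterra k := by
  refine ext_inner_left ℝ fun h => ?_
  rw [ContinuousLinearMap.adjoint_inner_right, inner_sub_right, real_inner_smul_right,
    real_inner_comm one h]
  linear_combination inner_volterra_add_inner_volterra h k

/-- A test function on `(0,1)`. -/
structure IsTestFunction (φ : ℝ → ℝ) : Prop where
  contDiff : ContDiff ℝ ∞ φ
  hasCompactSupport : HasCompactSupport φ
  tsupport_subset : tsupport φ ⊆ Ioo (0 : ℝ) 1

namespace IsTestFunction

variable {φ ψ : ℝ → ℝ}

theorem continuous (hφ : IsTestFunction φ) : Continuous φ := hφ.contDiff.continuous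

theorem continuous_deriv (hφ : IsTestFunction φ) : Continuous (deriv φ) :=
  hφ.contDiff.continuous_deriv (by simp)

theorem eq_zero_of_notMem (hφ : IsTestFunction φ) {x : ℝ} (hx : x ∉ Ioo (0 : ℝ) 1) : φ x = 0 :=
  image_eq_zero_of_notMem_tsupport fun hx' => hx (hφ.tsupport_subset hx')

theorem integral_eq (hφ : IsTestFunction φ) : ∫ x, φ x = inner ℝ one (toL2 φ hφ.continuous) := by
  rw [inner_one, integral_congr_ae (coeFn_toL2 hφ.continuous),
    setIntegral_eq_integral_of_forall_compl_eq_zero fun x hx => hφ.eq_zero_of_notMem hx]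

theorem add_const_mul (hφ : IsTestFunction φ) (c : ℝ) (hψ : IsTestFunction ψ) :
    IsTestFunction fun x => φ x + c * ψ x where
  contDiff := hφ.contDiff.add (contDiff_const.mul hψ.contDiff)
  hasCompactSupport := hφ.hasCompactSupport.add hψ.hasCompactSupport.mul_left
  tsupport_subset := (tsupport_add _ _).trans (union_subset hφ.tsupport_subset
    (tsupport_mul_subset_right.trans hψ.tsupport_subset))

theorem toL2_deriv (hφ : IsTestFunction φ) :
    volterra (toL2 (deriv φ) hφ.continuous_deriv) = toL2 φ hφ.continuous ∧
      inner ℝ one (toL2 (deriv φ) hφ.continuous_deriv) = 0 := by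
  have hderiv : ∀ x, HasDerivAt φ (deriv φ x) x := fun x =>
    (hφ.contDiff.differentiable (by simp) x).hasDerivAt
  constructor
  · rw [toL2_eq_const_add_volterra hφ.continuous hφ.continuous_deriv hderiv,
      hφ.eq_zero_of_notMem (by simp), zero_smul, zero_add]
  · rw [one, inner_toL2_toL2]
    simp_rw [one_mul]
    rw [intervalIntegral.integral_eq_sub_of_hasDerivAt (fun x _ => hderiv x)
      (hφ.continuous_deriv.intervalIntegrable _ _), hφ.eq_zero_of_notMem (by simp),
      hφ.eq_zero_of_notMem (by simp), sub_zero]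

end IsTestFunction

theorem isWeakDeriv_iff_inner {f g : L2} : IsWeakDeriv f g ↔
    ∀ (φ : ℝ → ℝ) (hφ : IsTestFunction φ),
      inner ℝ (toL2 (deriv φ) hφ.continuous_deriv) f = -inner ℝ (toL2 φ hφ.continuous) g := by
  simp only [IsWeakDeriv, inner_toL2, mul_comm (deriv _ _), mul_comm (_ : ℝ) (g _)]
  exact ⟨fun h φ hφ => h φ hφ.1 hφ.2 hφ.3, fun h φ h₁ h₂ h₃ => h φ ⟨h₁, h₂, h₃⟩⟩

theorem isWeakDeriv_const_add_volterra (c : ℝ) (h : L2) : IsWeakDeriv (c • one + volterra h) h := by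
  refine isWeakDeriv_iff_inner.mpr fun φ hφ => ?_
  have hparts := inner_volterra_add_inner_volterra (toL2 (deriv φ) hφ.continuous_deriv) h
  rw [hφ.toL2_deriv.1, hφ.toL2_deriv.2, zero_mul] at hparts
  rw [inner_add_right, real_inner_smul_right, real_inner_comm, hφ.toL2_deriv.2]
  linarith

theorem exists_subset_Icc_of_subset_Ioo {K : Set ℝ} (hK : IsCompact K) {p q : ℝ}
    (h : K ⊆ Ioo p q) : ∃ α β, p < α ∧ β < q ∧ K ⊆ Icc α β := by
  rcases K.eq_empty_or_nonempty with rfl | hne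
  · exact ⟨p + 1, q - 1, by simp⟩
  · obtain ⟨α, hα, hα'⟩ := hK.exists_isLeast hne
    obtain ⟨β, hβ, hβ'⟩ := hK.exists_isGreatest hne
    exact ⟨α, β, (h hα).1, (h hβ).2, fun x hx => ⟨hα' hx, hβ' hx⟩⟩

theorem tsupport_primitive_subset {θ : ℝ → ℝ} {p α β : ℝ} (hα : p < α)
    (hθ : ∀ x ∉ Icc α β, θ x = 0) (hint : ∫ x, θ x = 0) :
    tsupport (fun x => ∫ y in p..x, θ y) ⊆ Icc α β := by
  refine closure_minimal (fun x hx => ?_) isClosed_Icc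
  by_contra hxI
  refine hx ?_
  rcases lt_or_ge x α with hxα | hxα
  · refine intervalIntegral.integral_zero_ae (Eventually.of_forall fun y hy => hθ y fun hy' => ?_)
    exact hy'.1.not_gt (hy.2.trans_lt (max_lt hα hxα))
  · have hxβ : β < x := not_le.mp fun h => hxI ⟨hxα, h⟩
    have hsupp : Function.support θ ⊆ Ioc p x := fun y hy => by
      have hyI : y ∈ Icc α β := not_imp_comm.mp (hθ y) hy
      exact ⟨hα.trans_le hyI.1, hyI.2.trans hxβ.le⟩
    exact (intervalIntegral.integral_eq_integral_of_support_subset hsupp).trans hint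

theorem IsTestFunction.exists_deriv_eq {θ : ℝ → ℝ} (hθ : IsTestFunction θ)
    (hint : ∫ x, θ x = 0) : ∃ φ, IsTestFunction φ ∧ deriv φ = θ := by
  obtain ⟨α, β, hα, hβ, hsub⟩ :=
    exists_subset_Icc_of_subset_Ioo hθ.hasCompactSupport.isCompact hθ.tsupport_subset
  set φ : ℝ → ℝ := fun x => ∫ y in (0 : ℝ)..x, θ y
  have hsupp : tsupport φ ⊆ Icc α β := tsupport_primitive_subset hα
    (fun x hx => image_eq_zero_of_notMem_tsupport fun hx' => hx (hsub hx')) hint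
  have hφ : ∀ x, HasDerivAt φ (θ x) x := fun x =>
    intervalIntegral.integral_hasDerivAt_right (hθ.continuous.intervalIntegrable _ _)
      (hθ.continuous.stronglyMeasurableAtFilter _ _) hθ.continuous.continuousAt
  have hderiv : deriv φ = θ := funext fun x => (hφ x).deriv
  exact ⟨φ, ⟨contDiff_infty_iff_deriv.mpr
    ⟨fun x => (hφ x).differentiableAt, hderiv.symm ▸ hθ.contDiff⟩,
    isCompact_Icc.of_isClosed_subset (isClosed_tsupport _) hsupp,
    hsupp.trans (Icc_subset_Ioo hα hβ)⟩, hderiv⟩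

theorem exists_isTestFunction_integral_eq_one : ∃ ρ, IsTestFunction ρ ∧ ∫ x, ρ x = 1 := by
  let b : ContDiffBump (1 / 2 : ℝ) := ⟨1 / 8, 1 / 4, by norm_num, by norm_num⟩
  refine ⟨b.normed volume, ⟨b.contDiff_normed, b.hasCompactSupport_normed, ?_⟩, b.integral_normed⟩
  rw [b.tsupport_normed_eq, Real.closedBall_eq_Icc]
  exact Icc_subset_Ioo (by norm_num [b]) (by norm_num [b])

theorem eq_zero_of_inner_isTestFunction {h : L2}
    (hh : ∀ φ (hφ : IsTestFunction φ), inner ℝ (toL2 φ hφ.continuous) h = 0) : h = 0 := by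
  refine IsWeakDeriv.unique (f := 0) (isWeakDeriv_iff_inner.mpr fun φ hφ => ?_) isWeakDeriv_zero
  rw [hh φ hφ, inner_zero_right, neg_zero]

/-- Du Bois-Reymond: a test function of mean zero is the derivative of a test function. -/
theorem IsWeakDeriv.eq_smul_one {d : L2} (hd : IsWeakDeriv d 0) : ∃ c : ℝ, d = c • one := by
  have hmean : ∀ θ (hθ : IsTestFunction θ), ∫ x, θ x = 0 →
      inner ℝ (toL2 θ hθ.continuous) d = 0 := fun θ hθ hint => by
    obtain ⟨φ, hφ, rfl⟩ := hθ.exists_deriv_eq hint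
    rw [isWeakDeriv_iff_inner.mp hd φ hφ, inner_zero_right, neg_zero]
  obtain ⟨ρ, hρ, hρ1⟩ := exists_isTestFunction_integral_eq_one
  refine ⟨inner ℝ (toL2 ρ hρ.continuous) d, sub_eq_zero.mp
    (eq_zero_of_inner_isTestFunction fun η hη => ?_)⟩
  set m := inner ℝ one (toL2 η hη.continuous) with hm
  have hηρ := hη.add_const_mul (-m) hρ
  have hsplit : toL2 (fun x => η x + -m * ρ x) hηρ.continuous =
      toL2 η hη.continuous + (-m) • toL2 ρ hρ.continuous := by rw [toL2_smul, toL2_add]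
  have hzero := hmean _ hηρ (by
    rw [hηρ.integral_eq, hsplit, inner_add_right, real_inner_smul_right, ← hρ.integral_eq, hρ1, hm]
    ring)
  rw [hsplit, inner_add_left, real_inner_smul_left] at hzero
  rw [inner_sub_right, real_inner_smul_right, real_inner_comm one, ← hm]
  linarith

theorem isWeakDeriv_iff {f h : L2} : IsWeakDeriv f h ↔ ∃ c : ℝ, f = c • one + volterra h := by
  constructor
  · intro hf
    have hdiff := hf.add ((isWeakDeriv_const_add_volterra 0 h).smul (-1))
    rw [neg_one_smul, neg_one_smul, add_neg_cancel, zero_smul, zero_add] at hdiff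
    obtain ⟨c, hc⟩ := hdiff.eq_smul_one
    exact ⟨c, by rw [← hc]; abel⟩
  · rintro ⟨c, rfl⟩
    exact isWeakDeriv_const_add_volterra c h

theorem isWeakDeriv_toL2 {F F' : ℝ → ℝ} (hF : Continuous F) (hF' : Continuous F')
    (h : ∀ x, HasDerivAt F (F' x) x) : IsWeakDeriv (toL2 F hF) (toL2 F' hF') :=
  isWeakDeriv_iff.mpr ⟨F 0, toL2_eq_const_add_volterra hF hF' h⟩

theorem hasTrace_toL2 {F : ℝ → ℝ} (hF : Continuous F) (x : ℝ) : HasTrace (toL2 F hF) x (F x) :=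
  ⟨F, hF.continuousOn, coeFn_toL2 hF, rfl⟩

theorem HasTrace.unique {f : L2} {x v w : ℝ} (hx : x ∈ Icc (0 : ℝ) 1) (hv : HasTrace f x v)
    (hw : HasTrace f x w) : v = w := by
  obtain ⟨F, hF, hfF, rfl⟩ := hv
  obtain ⟨G, hG, hfG, rfl⟩ := hw
  refine Measure.eqOn_Icc_of_ae_eq volume zero_ne_one ?_ hF hG hx
  rw [← restrict_Ioo_eq_restrict_Icc]
  exact hfF.symm.trans hfG

theorem isWeakDeriv_and_hasTrace_zero_iff {f h : L2} {v : ℝ} :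
    IsWeakDeriv f h ∧ HasTrace f 0 v ↔ f = v • one + volterra h := by
  have htrace (c : ℝ) : HasTrace (c • one + volterra h) 0 c := by
    simpa [const_add_volterra, prim_zero] using hasTrace_toL2 (continuous_const_add_prim c h) 0
  constructor
  · rintro ⟨hf, hv⟩
    obtain ⟨c, rfl⟩ := isWeakDeriv_iff.mp hf
    rw [hv.unique (by simp) (htrace c)]
  · rintro rfl
    exact ⟨isWeakDeriv_const_add_volterra v h, htrace v⟩

theorem isWeakDeriv_and_hasTrace_one_iff {f h : L2} :
    IsWeakDeriv f h ∧ HasTrace f 1 0 ↔ f = -(volterra†) h := by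
  have htrace (c : ℝ) : HasTrace (c • one + volterra h) 1 (c + inner ℝ one h) := by
    simpa [const_add_volterra, prim_one] using hasTrace_toL2 (continuous_const_add_prim c h) 1
  have hadj : -(volterra†) h = (-inner ℝ one h) • one + volterra h := by
    rw [adjoint_volterra_apply, neg_smul, neg_sub, sub_eq_neg_add]
  rw [hadj]
  constructor
  · rintro ⟨hf, hv⟩
    obtain ⟨c, rfl⟩ := isWeakDeriv_iff.mp hf
    rw [eq_neg_of_add_eq_zero_left (hv.unique (by simp) (htrace c)).symm]
  · rintro rfl
    exact ⟨isWeakDeriv_const_add_volterra _ h, by simpa using htrace (-inner ℝ one h)⟩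

end Sobolev

/-! ### The graph of the operator -/

section Operator

variable {a b s : ℝ} {u w : H0}

theorem mem_graph_coupledOp_iff_exists_isWeakDeriv :
    (u, w) ∈ (coupledOp a b s).graph ↔ ∃ (c : ℝ) (f' g' : L2),
      (IsWeakDeriv u.snd g' ∧ HasTrace u.snd 0 c) ∧
      (IsWeakDeriv g' (w.snd - b • u.snd) ∧ HasTrace g' 0 0) ∧ HasTrace g' 1 0 ∧
      (IsWeakDeriv u.fst f' ∧ HasTrace u.fst 1 0) ∧
      (IsWeakDeriv f' (w.fst - a • u.fst) ∧ HasTrace f' 0 (s * c)) := by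
  rw [LinearPMap.mem_graph_iff]
  constructor
  · rintro ⟨⟨y, hf, hg, hf1, hg0, hg1, c, hc, hfc⟩, rfl, rfl⟩
    refine ⟨c, _, _, ⟨hg.isWeakDeriv, hc⟩, ⟨?_, hg0⟩, hg1, ⟨hf.isWeakDeriv, hf1⟩, ⟨?_, hfc⟩⟩
    · simpa [coupledOp] using hg.isWeakDeriv₂
    · simpa [coupledOp] using hf.isWeakDeriv₂
  · rintro ⟨c, f', g', ⟨hg, hc⟩, ⟨hg', hg0⟩, hg1, ⟨hf, hf1⟩, ⟨hf', hfc⟩⟩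
    have hu : u ∈ (coupledOp a b s).domain :=
      ⟨⟨f', _, hf, hf'⟩, ⟨g', _, hg, hg'⟩, hf1, hg.eq.symm ▸ hg0, hg.eq.symm ▸ hg1, c, hc,
        hf.eq.symm ▸ hfc⟩
    refine ⟨⟨u, hu⟩, rfl, ?_⟩
    change WithLp.toLp 2 (weakDeriv (weakDeriv u.fst) + a • u.fst,
      weakDeriv (weakDeriv u.snd) + b • u.snd) = w
    rw [hf.eq, hf'.eq, hg.eq, hg'.eq, sub_add_cancel, sub_add_cancel]
    rfl

theorem hasTrace_volterra_one_iff {k : L2} :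
    HasTrace (volterra k) 1 0 ↔ inner ℝ one k = 0 := by
  have htrace : HasTrace (volterra k) 1 (inner ℝ one k) :=
    prim_one k ▸ hasTrace_toL2 (continuous_prim k) 1
  exact ⟨fun h => htrace.unique (by simp) h, fun h => h ▸ htrace⟩

/-- The boundary value problems solved: `volterra` integrates from the endpoint `0`, and its
negative adjoint from the endpoint `1`. -/
theorem mem_graph_coupledOp_iff : (u, w) ∈ (coupledOp a b s).graph ↔ ∃ c : ℝ,
    inner ℝ one (w.snd - b • u.snd) = 0 ∧
    u.snd = c • one + volterra (volterra (w.snd - b • u.snd)) ∧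
    u.fst = -(volterra†) ((s * c) • one + volterra (w.fst - a • u.fst)) := by
  rw [mem_graph_coupledOp_iff_exists_isWeakDeriv]
  simp only [isWeakDeriv_and_hasTrace_zero_iff, isWeakDeriv_and_hasTrace_one_iff, zero_smul,
    zero_add]
  constructor
  · rintro ⟨c, f', g', hg, rfl, hg1, hf, rfl⟩
    exact ⟨c, hasTrace_volterra_one_iff.mp hg1, hg, hf⟩
  · rintro ⟨c, hk, hg, hf⟩
    exact ⟨c, _, _, hg, rfl, hasTrace_volterra_one_iff.mpr hk, hf, rfl⟩

theorem isClosed_coupledOp (a b s : ℝ) : (coupledOp a b s).IsClosed := by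
  set C : H0 × H0 → ℝ := fun p =>
    inner ℝ one (p.1.snd - volterra (volterra (p.2.snd - b • p.1.snd))) with hC
  have hCcont : Continuous C := by fun_prop
  have hset : ((coupledOp a b s).graph : Set (H0 × H0)) =
      {p | inner ℝ one (p.2.snd - b • p.1.snd) = 0} ∩
      ({p | p.1.snd = C p • one + volterra (volterra (p.2.snd - b • p.1.snd))} ∩
      {p | p.1.fst = -(volterra†) ((s * C p) • one + volterra (p.2.fst - a • p.1.fst))}) := by
    ext ⟨u, w⟩
    rw [SetLike.mem_coe, mem_graph_coupledOp_iff]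
    constructor
    · rintro ⟨c, hk, hg, hf⟩
      have hc : C (u, w) = c := by
        simp only [hC]
        rw [sub_eq_iff_eq_add.mpr hg, inner_smul_right, inner_one_one, mul_one]
      subst hc
      exact ⟨hk, hg, hf⟩
    · rintro ⟨hk, hg, hf⟩
      exact ⟨C (u, w), hk, hg, hf⟩
  change IsClosed ((coupledOp a b s).graph : Set (H0 × H0))
  rw [hset]
  exact (isClosed_eq (by fun_prop) continuous_const).inter
    ((isClosed_eq (by fun_prop) (by fun_prop)).inter (isClosed_eq (by fun_prop) (by fun_prop)))

theorem eq_zero_of_inner_smul_self_eq_neg_norm_sq {f : L2} {κ : ℝ} (hκ : 0 < κ) (h : L2)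
    (hf : inner ℝ (κ • f) f = -‖h‖ ^ 2) : f = 0 := by
  rw [real_inner_smul_left, real_inner_self_eq_norm_sq] at hf
  have hnorm : κ * ‖f‖ ^ 2 = 0 := le_antisymm (by linarith [sq_nonneg ‖h‖]) (by positivity)
  simpa [hκ.ne'] using hnorm

theorem eq_zero_of_eq_const_add_volterra_volterra {g : L2} {κ c : ℝ} (hκ : 0 < κ)
    (hmean : inner ℝ one (κ • g) = 0) (hg : g = c • one + volterra (volterra (κ • g))) :
    g = 0 := by
  refine eq_zero_of_inner_smul_self_eq_neg_norm_sq hκ (volterra (κ • g)) ?_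
  have hparts := inner_volterra_add_inner_volterra (κ • g) (volterra (κ • g))
  rw [hmean, zero_mul, real_inner_self_eq_norm_sq] at hparts
  calc inner ℝ (κ • g) g = inner ℝ (κ • g) (c • one + volterra (volterra (κ • g))) := by rw [← hg]
    _ = -‖volterra (κ • g)‖ ^ 2 := by
      rw [inner_add_right, real_inner_smul_right, real_inner_comm, hmean]
      linarith

theorem eq_zero_of_eq_neg_adjoint_volterra_volterra {f : L2} {κ : ℝ} (hκ : 0 < κ)
    (hf : f = -(volterra†) (volterra (κ • f))) : f = 0 := by
  refine eq_zero_of_inner_smul_self_eq_neg_norm_sq hκ (volterra (κ • f)) ?_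
  calc inner ℝ (κ • f) f = inner ℝ (κ • f) (-(volterra†) (volterra (κ • f))) := by rw [← hf]
    _ = -‖volterra (κ • f)‖ ^ 2 := by
      rw [inner_neg_right, ContinuousLinearMap.adjoint_inner_right, real_inner_self_eq_norm_sq]

theorem eq_zero_of_smul_mem_graph_coupledOp {l : ℝ} (ha : a < l) (hb : b < l)
    (hu : (u, l • u) ∈ (coupledOp a b s).graph) : u = 0 := by
  obtain ⟨c, hmean, hg, hf⟩ := mem_graph_coupledOp_iff.mp hu
  simp only [WithLp.smul_fst, WithLp.smul_snd, ← sub_smul] at hmean hg hf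
  have hg0 : u.snd = 0 := eq_zero_of_eq_const_add_volterra_volterra (sub_pos.mpr hb) hmean hg
  have hc : c = 0 := by
    rw [hg0, smul_zero, map_zero, map_zero, add_zero] at hg
    simpa only [inner_zero_right, inner_smul_right, inner_one_one, mul_one]
      using (congrArg (inner ℝ one) hg).symm
  rw [hc, mul_zero, zero_smul, zero_add] at hf
  have hf0 : u.fst = 0 := eq_zero_of_eq_neg_adjoint_volterra_volterra (sub_pos.mpr ha) hf
  exact WithLp.ofLp_injective 2 (Prod.ext hf0 hg0)

end Operator

/-! ### Cosine bases -/

section Cosine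

open Real

variable {k : ℝ → ℝ}

theorem integrable_continuous_mul {F : ℝ → ℝ} (hF : Continuous F) (hk : Integrable k mu01) :
    Integrable (fun x => F x * k x) mu01 := by
  obtain ⟨C, hC⟩ := isCompact_Icc.exists_bound_of_continuousOn (s := Icc (0 : ℝ) 1)
    hF.continuousOn
  refine hk.bdd_mul (c := C) hF.aestronglyMeasurable ?_
  filter_upwards [ae_restrict_mem measurableSet_Ioo] with x hx
  exact hC x (Ioo_subset_Icc_self hx)

theorem span_range_chebyshev_T :
    Submodule.span ℝ (range fun n : ℕ => Polynomial.Chebyshev.T ℝ n) = ⊤ := by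
  let S : Polynomial.Sequence ℝ :=
    ⟨fun n => Polynomial.Chebyshev.T ℝ n, fun n => by simp [Polynomial.Chebyshev.degree_T]⟩
  exact S.span fun n => (Polynomial.leadingCoeff_ne_zero.mpr (S.ne_zero n)).isUnit

/-- The Chebyshev polynomial `Tₘ` is the one with `Tₘ (cos θ) = cos (m θ)`. -/
theorem integral_polynomial_cos_mul_eq_zero (hk : Integrable k mu01)
    (h : ∀ m : ℕ, ∫ x in Ioo (0 : ℝ) 1, cos (m * π * x) * k x = 0) (p : Polynomial ℝ) :
    ∫ x in Ioo (0 : ℝ) 1, p.eval (cos (π * x)) * k x = 0 := by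
  have hp : p ∈ Submodule.span ℝ (range fun n : ℕ => Polynomial.Chebyshev.T ℝ n) :=
    span_range_chebyshev_T ▸ Submodule.mem_top
  induction hp using Submodule.span_induction with
  | mem p hp =>
    obtain ⟨m, rfl⟩ := hp
    simpa [Polynomial.Chebyshev.T_real_cos, mul_assoc] using h m
  | zero => simp
  | add p q _ _ hp hq =>
    simp_rw [Polynomial.eval_add, add_mul]
    rw [integral_add (integrable_continuous_mul (by fun_prop) hk)
      (integrable_continuous_mul (by fun_prop) hk), hp, hq, add_zero]
  | smul c p _ hp =>
    simp_rw [Polynomial.eval_smul, smul_mul_assoc]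
    rw [integral_smul, hp, smul_zero]

theorem exists_polynomial_cos_near {g : ℝ → ℝ} (hg : Continuous g) {ε : ℝ} (hε : 0 < ε) :
    ∃ p : Polynomial ℝ, ∀ x ∈ Icc (0 : ℝ) 1, |g x - p.eval (cos (π * x))| ≤ ε := by
  obtain ⟨p, hp⟩ := exists_polynomial_near_of_continuousOn (-1) 1 (fun y => g (arccos y / π))
    (hg.comp (continuous_arccos.div_const π)).continuousOn ε hε
  refine ⟨p, fun x hx => ?_⟩
  have hnear := hp (cos (π * x)) ⟨neg_one_le_cos _, cos_le_one _⟩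
  rw [arccos_cos (mul_nonneg pi_pos.le hx.1) (mul_le_of_le_one_right pi_pos.le hx.2),
    mul_div_cancel_left₀ _ pi_ne_zero, abs_sub_comm] at hnear
  exact hnear.le

theorem integral_continuous_mul_eq_zero (hk : Integrable k mu01)
    (h : ∀ m : ℕ, ∫ x in Ioo (0 : ℝ) 1, cos (m * π * x) * k x = 0) {g : ℝ → ℝ}
    (hg : Continuous g) : ∫ x in Ioo (0 : ℝ) 1, g x * k x = 0 := by
  set M := ∫ x in Ioo (0 : ℝ) 1, |k x|
  have hM : 0 < M + 1 := by linarith [show 0 ≤ M from integral_nonneg fun x => abs_nonneg _]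
  refine abs_eq_zero.mp (le_antisymm (le_of_forall_pos_le_add fun ε hε => ?_) (abs_nonneg _))
  obtain ⟨p, hp⟩ := exists_polynomial_cos_near hg (ε := ε / (M + 1)) (div_pos hε hM)
  have hsub : ∫ x in Ioo (0 : ℝ) 1, g x * k x =
      ∫ x in Ioo (0 : ℝ) 1, (g x * k x - p.eval (cos (π * x)) * k x) := by
    rw [integral_sub (integrable_continuous_mul hg hk)
      (integrable_continuous_mul (by fun_prop) hk),
      integral_polynomial_cos_mul_eq_zero hk h, sub_zero]
  calc |∫ x in Ioo (0 : ℝ) 1, g x * k x|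
      ≤ ∫ x in Ioo (0 : ℝ) 1, ε / (M + 1) * |k x| := by
        rw [hsub, ← norm_eq_abs]
        refine norm_integral_le_of_norm_le (hk.abs.const_mul _) ?_
        filter_upwards [ae_restrict_mem measurableSet_Ioo] with x hx
        rw [← sub_mul, norm_mul]
        exact mul_le_mul_of_nonneg_right (hp x (Ioo_subset_Icc_self hx)) (norm_nonneg _)
    _ = ε / (M + 1) * M := integral_const_mul _ _
    _ ≤ 0 + ε := by
        rw [zero_add, div_mul_eq_mul_div, div_le_iff₀ hM]
        linarith

theorem ae_eq_zero_of_integral_cos_mul_eq_zero (hk : Integrable k mu01)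
    (h : ∀ m : ℕ, ∫ x in Ioo (0 : ℝ) 1, cos (m * π * x) * k x = 0) : k =ᵐ[mu01] 0 := by
  refine (ae_restrict_iff' measurableSet_Ioo).mpr
    (isOpen_Ioo.ae_eq_zero_of_integral_contDiff_smul_eq_zero
      (IntegrableOn.locallyIntegrableOn hk) fun φ hφ _ hsupp => ?_)
  rw [← setIntegral_eq_integral_of_forall_compl_eq_zero (s := Ioo (0 : ℝ) 1) fun x hx => by
    rw [image_eq_zero_of_notMem_tsupport fun hx' => hx (hsupp hx'), zero_smul]]
  exact integral_continuous_mul_eq_zero hk h hφ.continuous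

theorem L2_eq_zero_of_integral_cos_int {h : L2}
    (hh : ∀ m : ℕ, ∫ x in Ioo (0 : ℝ) 1, cos (m * π * x) * h x = 0) : h = 0 :=
  Lp.ext ((ae_eq_zero_of_integral_cos_mul_eq_zero (integrable_L2 h) hh).trans
    (Lp.coeFn_zero ℝ 2 mu01).symm)

/-- Multiplication by `cos (π x / 2)`, which does not vanish on `(0,1)`, turns frequencies in
`ℕ + 1/2` into frequencies in `ℕ`. -/
theorem L2_eq_zero_of_integral_cos_half {h : L2}
    (hh : ∀ n : ℕ, ∫ x in Ioo (0 : ℝ) 1, cos ((n + 1 / 2) * π * x) * h x = 0) : h = 0 := by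
  have hcos : ∀ m : ℕ, ∫ x in Ioo (0 : ℝ) 1, cos (m * π * x) * (cos (π / 2 * x) * h x) = 0 := by
    rintro (_ | m)
    · simpa [div_eq_inv_mul] using hh 0
    · have hprod (x : ℝ) : cos ((m + 1 : ℕ) * π * x) * (cos (π / 2 * x) * h x) =
          1 / 2 * (cos (((m + 1 : ℕ) + 1 / 2) * π * x) * h x +
            cos ((m + 1 / 2) * π * x) * h x) := by
        rw [show (((m + 1 : ℕ) : ℝ) + 1 / 2) * π * x = (m + 1 : ℕ) * π * x + π / 2 * x by ring,
          show ((m : ℝ) + 1 / 2) * π * x = (m + 1 : ℕ) * π * x - π / 2 * x by push_cast; ring,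
          cos_add, cos_sub]
        ring
      simp_rw [hprod]
      rw [integral_const_mul, integral_add
        (integrable_continuous_mul (by fun_prop) (integrable_L2 h))
        (integrable_continuous_mul (by fun_prop) (integrable_L2 h)), hh, hh, add_zero, mul_zero]
  refine Lp.ext (EventuallyEq.trans ?_ (Lp.coeFn_zero ℝ 2 mu01).symm)
  filter_upwards [ae_eq_zero_of_integral_cos_mul_eq_zero
    (integrable_continuous_mul (by fun_prop) (integrable_L2 h)) hcos,
    ae_restrict_mem measurableSet_Ioo] with x hx hx01
  have hpos : 0 < cos (π / 2 * x) := cos_pos_of_mem_Ioo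
    ⟨by nlinarith [hx01.1, pi_pos], by nlinarith [hx01.2, pi_pos]⟩
  exact (mul_eq_zero.mp hx).resolve_left hpos.ne'

theorem integral_cos_int_mul_pi (j : ℤ) :
    ∫ x in (0 : ℝ)..1, cos (j * π * x) = if j = 0 then 1 else 0 := by
  split_ifs with h
  · simp [h]
  · have hne : (j : ℝ) * π ≠ 0 := mul_ne_zero (by exact_mod_cast h) pi_ne_zero
    rw [intervalIntegral.integral_comp_mul_left _ hne, integral_cos]
    simp [sin_int_mul_pi]

theorem integral_cos_mul_cos {p q : ℝ} {i j : ℤ} (hi : p - q = i) (hj : p + q = j) :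
    ∫ x in (0 : ℝ)..1, cos (p * π * x) * cos (q * π * x) =
      ((if i = 0 then 1 else 0) + if j = 0 then 1 else 0) / 2 := by
  have hprod (x : ℝ) : cos (p * π * x) * cos (q * π * x) =
      (cos (i * π * x) + cos (j * π * x)) / 2 := by
    rw [← hi, ← hj, show (p - q) * π * x = p * π * x - q * π * x by ring,
      show (p + q) * π * x = p * π * x + q * π * x by ring, cos_sub, cos_add]
    ring
  simp_rw [hprod]
  rw [intervalIntegral.integral_div, intervalIntegral.integral_add
    (Continuous.intervalIntegrable (by fun_prop) _ _)
    (Continuous.intervalIntegrable (by fun_prop) _ _), integral_cos_int_mul_pi,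
    integral_cos_int_mul_pi]

theorem muCoef_eq (m : ℕ) : muCoef m = if m = 0 then 1 else √2 := by simp [muCoef, phi₂₂]

theorem phi₂₂_eq (m : ℕ) (x : ℝ) : phi₂₂ m x = muCoef m * cos (m * π * x) := by
  rw [muCoef_eq, phi₂₂]
  split_ifs with h <;> simp [h]

theorem muCoef_pos (m : ℕ) : 0 < muCoef m := by
  rw [muCoef_eq]
  split_ifs <;> positivity

/-- The second components of the family `Phi₂` as elements of `L²(0,1)`. -/
def cosInt (m : ℕ) : L2 := toL2 (phi₂₂ m) (continuous_phi₂₂ m)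

/-- The first components of the family `Phi₁` as elements of `L²(0,1)`. -/
def cosHalf (n : ℕ) : L2 := toL2 (phi₁₁ n) (continuous_phi₁₁ n)

theorem orthonormal_cosInt : Orthonormal ℝ cosInt := by
  rw [orthonormal_iff_ite]
  intro m m'
  have hscale (x : ℝ) : phi₂₂ m x * phi₂₂ m' x =
      muCoef m * muCoef m' * (cos (m * π * x) * cos (m' * π * x)) := by
    rw [phi₂₂_eq, phi₂₂_eq]
    ring
  rw [cosInt, cosInt, inner_toL2_toL2]
  simp_rw [hscale]
  rw [intervalIntegral.integral_const_mul, integral_cos_mul_cos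
    (i := (m : ℤ) - m') (j := (m : ℤ) + m') (by push_cast; ring) (by push_cast; ring)]
  rcases eq_or_ne m m' with rfl | hne
  · rcases eq_or_ne m 0 with rfl | hm
    · simp [muCoef_eq]
    · simp [muCoef_eq, hm]
  · rw [if_neg (by omega), if_neg (by omega), if_neg hne, add_zero, zero_div, mul_zero]

theorem orthonormal_cosHalf : Orthonormal ℝ cosHalf := by
  rw [orthonormal_iff_ite]
  intro n n'
  have hscale (x : ℝ) : phi₁₁ n x * phi₁₁ n' x =
      2 * (cos ((n + 1 / 2) * π * x) * cos ((n' + 1 / 2) * π * x)) := by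
    rw [phi₁₁, phi₁₁, mul_mul_mul_comm, mul_self_sqrt zero_le_two]
  rw [cosHalf, cosHalf, inner_toL2_toL2]
  simp_rw [hscale]
  rw [intervalIntegral.integral_const_mul, integral_cos_mul_cos
    (i := (n : ℤ) - n') (j := (n : ℤ) + n' + 1) (by push_cast; ring) (by push_cast; ring),
    if_neg (show (n : ℤ) + n' + 1 ≠ 0 by omega), add_zero, mul_div_cancel₀ _ two_ne_zero]
  simp only [sub_eq_zero, Nat.cast_inj]

theorem eq_zero_of_inner_cosInt {h : L2} (hh : ∀ m, inner ℝ (cosInt m) h = 0) : h = 0 := by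
  refine L2_eq_zero_of_integral_cos_int fun m => ?_
  have hm := hh m
  simp_rw [cosInt, inner_toL2, phi₂₂_eq, mul_assoc (muCoef m)] at hm
  rw [integral_const_mul] at hm
  exact (mul_eq_zero.mp hm).resolve_left (muCoef_pos m).ne'

theorem eq_zero_of_inner_cosHalf {h : L2} (hh : ∀ n, inner ℝ (cosHalf n) h = 0) : h = 0 := by
  refine L2_eq_zero_of_integral_cos_half fun n => ?_
  have hn := hh n
  simp_rw [cosHalf, inner_toL2, phi₁₁, mul_assoc √2] at hn
  rw [integral_const_mul] at hn
  exact (mul_eq_zero.mp hn).resolve_left (by simp)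

theorem span_orthogonal_eq_bot {ι E : Type*} [NormedAddCommGroup E] [InnerProductSpace ℝ E]
    {v : ι → E} (hv : ∀ x, (∀ i, inner ℝ (v i) x = 0) → x = 0) :
    (Submodule.span ℝ (range v))ᗮ = ⊥ :=
  (Submodule.eq_bot_iff _).mpr fun x hx => hv x fun i =>
    (Submodule.mem_orthogonal _ x).mp hx _ (Submodule.subset_span ⟨i, rfl⟩)

/-- The family `cosInt` as a Hilbert basis of `L²(0,1)`. -/
def cosIntBasis : HilbertBasis ℕ ℝ L2 :=
  HilbertBasis.mkOfOrthogonalEqBot orthonormal_cosInt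
    (span_orthogonal_eq_bot fun _ => eq_zero_of_inner_cosInt)

theorem coe_cosIntBasis : ⇑cosIntBasis = cosInt := HilbertBasis.coe_mkOfOrthogonalEqBot _ _

/-- The family of all `(cosHalf n, 0)` and all `(0, cosInt m)`. -/
def cosFamily : ℕ ⊕ ℕ → H0 :=
  Sum.elim (fun n => WithLp.toLp 2 (cosHalf n, 0)) (fun m => WithLp.toLp 2 (0, cosInt m))

theorem orthonormal_cosFamily : Orthonormal ℝ cosFamily := by
  rw [orthonormal_iff_ite]
  rintro (n | m) (n' | m')
  · simpa [cosFamily, WithLp.prod_inner_apply] using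
      orthonormal_iff_ite.mp orthonormal_cosHalf n n'
  · simp [cosFamily, WithLp.prod_inner_apply]
  · simp [cosFamily, WithLp.prod_inner_apply]
  · simpa [cosFamily, WithLp.prod_inner_apply] using
      orthonormal_iff_ite.mp orthonormal_cosInt m m'

theorem eq_zero_of_inner_cosFamily {u : H0} (hu : ∀ i, inner ℝ (cosFamily i) u = 0) : u = 0 := by
  have hfst : u.fst = 0 := eq_zero_of_inner_cosHalf fun n => by
    simpa [cosFamily, WithLp.prod_inner_apply] using hu (Sum.inl n)
  have hsnd : u.snd = 0 := eq_zero_of_inner_cosInt fun m => by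
    simpa [cosFamily, WithLp.prod_inner_apply] using hu (Sum.inr m)
  exact WithLp.ofLp_injective 2 (Prod.ext hfst hsnd)

/-- The family `cosFamily` as a Hilbert basis of `L²(0,1) × L²(0,1)`. -/
def cosBasis : HilbertBasis (ℕ ⊕ ℕ) ℝ H0 :=
  HilbertBasis.mkOfOrthogonalEqBot orthonormal_cosFamily
    (span_orthogonal_eq_bot fun _ => eq_zero_of_inner_cosFamily)

theorem coe_cosBasis : ⇑cosBasis = cosFamily := HilbertBasis.coe_mkOfOrthogonalEqBot _ _

end Cosine

/-! ### The boundary value problems solved by the family -/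

section BoundaryValueProblem

open Real

theorem hasDerivAt_mul_cos (c w x : ℝ) :
    HasDerivAt (fun x => c * cos (w * x)) (-(c * w) * sin (w * x)) x :=
  (((hasDerivAt_const_mul w).cos).const_mul c).congr_deriv (by ring)

theorem hasDerivAt_mul_sin (c w x : ℝ) :
    HasDerivAt (fun x => c * sin (w * x)) (c * w * cos (w * x)) x :=
  (((hasDerivAt_const_mul w).sin).const_mul c).congr_deriv (by ring)

theorem cos_half_pi (n : ℕ) : cos ((n + 1 / 2) * π) = 0 :=
  cos_eq_zero_iff.mpr ⟨n, by push_cast; ring⟩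

/-- The boundary value problem `f'' = κ f + r`, `f(1) = 0`, `f'(0) = σ`, which is what the
eigenvalue equation of `coupledOp` imposes on the first component; `r` is the resonant term. -/
def SolvesBVP (κ σ : ℝ) (r f : ℝ → ℝ) : Prop :=
  ∃ f' : ℝ → ℝ, (∀ x, HasDerivAt f (f' x) x) ∧ (∀ x, HasDerivAt f' (κ * f x + r x) x) ∧
    f 1 = 0 ∧ f' 0 = σ

theorem mem_graph_of_solvesBVP {a b s κ ν : ℝ} {f r g g' : ℝ → ℝ} (hf : Continuous f)
    (hr : Continuous r) (hg : Continuous g) (hfr : SolvesBVP κ (s * g 0) r f)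
    (dg : ∀ x, HasDerivAt g (g' x) x) (dg' : ∀ x, HasDerivAt g' (ν * g x) x) (h0 : g' 0 = 0)
    (h1 : g' 1 = 0) :
    (WithLp.toLp 2 (toL2 f hf, toL2 g hg),
      WithLp.toLp 2 ((a + κ) • toL2 f hf + toL2 r hr, (b + ν) • toL2 g hg)) ∈
      (coupledOp a b s).graph := by
  obtain ⟨f', df, df', hf1, hf0⟩ := hfr
  have hf' : Continuous f' := continuous_iff_continuousAt.mpr fun x => (df' x).continuousAt
  have hg' : Continuous g' := continuous_iff_continuousAt.mpr fun x => (dg' x).continuousAt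
  have ef : (a + κ) • toL2 f hf + toL2 r hr - a • toL2 f hf =
      toL2 (fun x => κ * f x + r x) ((hf.const_mul κ).add hr) := by
    rw [← toL2_add (hf.const_mul κ) hr, ← toL2_smul κ hf]
    module
  have eg : (b + ν) • toL2 g hg - b • toL2 g hg = toL2 (fun x => ν * g x) (hg.const_mul ν) := by
    rw [← toL2_smul ν hg]
    module
  rw [mem_graph_coupledOp_iff_exists_isWeakDeriv]
  refine ⟨g 0, toL2 f' hf', toL2 g' hg', ⟨isWeakDeriv_toL2 hg hg' dg, hasTrace_toL2 hg 0⟩,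
    ⟨?_, by simpa only [h0] using hasTrace_toL2 hg' 0⟩, h1 ▸ hasTrace_toL2 hg' 1,
    ⟨isWeakDeriv_toL2 hf hf' df, hf1 ▸ hasTrace_toL2 hf 1⟩, ⟨?_, hf0 ▸ hasTrace_toL2 hf' 0⟩⟩
  · exact eg ▸ isWeakDeriv_toL2 hg' (hg.const_mul ν) dg'
  · exact ef ▸ isWeakDeriv_toL2 hf' ((hf.const_mul κ).add hr) df'

theorem solvesBVP_phi₁₁ (n : ℕ) : SolvesBVP (-((n + 1 / 2) * π) ^ 2) 0 (fun _ => 0) (phi₁₁ n) :=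
  ⟨_, fun x => hasDerivAt_mul_cos _ _ x,
    fun x => (hasDerivAt_mul_sin _ _ x).congr_deriv (by rw [phi₁₁]; ring),
    by rw [phi₁₁, mul_one, cos_half_pi, mul_zero], by simp⟩

theorem solvesBVP_one_sub_mul_sin (c w : ℝ) : SolvesBVP (-w ^ 2) (c * w)
    (fun x => -(2 * (c * w)) * cos (w * x)) (fun x => (1 - x) * (c * sin (w * x))) := by
  have dl (x : ℝ) : HasDerivAt (fun x : ℝ => 1 - x) (-1) x := (hasDerivAt_id x).const_sub 1
  refine ⟨_, fun x => (dl x).mul (hasDerivAt_mul_sin c w x), fun x =>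
    (((hasDerivAt_mul_sin c w x).const_mul (-1)).add
      ((dl x).mul (hasDerivAt_mul_cos (c * w) w x))).congr_deriv ?_, by simp, by simp⟩
  ring

theorem solvesBVP_linear (σ : ℝ) : SolvesBVP 0 σ (fun _ => 0) (fun x => σ * (-1 + x)) :=
  ⟨fun _ => σ, fun x => by simpa using ((hasDerivAt_id x).const_add (-1)).const_mul σ,
    fun x => by simpa using hasDerivAt_const x σ, by simp, rfl⟩

theorem solvesBVP_sinh {κ σ : ℝ} {r : ℂ} (hr : r ^ 2 = κ) (hr₀ : r ≠ 0)
    (hcosh : Complex.cosh r ≠ 0) : SolvesBVP κ σ (fun _ => 0) fun x =>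
      (-(σ : ℂ) / (r * Complex.cosh r) * Complex.sinh (r * (1 - (x : ℂ)))).re := by
  have dl (x : ℝ) : HasDerivAt (fun x : ℝ => r * (1 - (x : ℂ))) (-r) x := by
    simpa using (((hasDerivAt_id x).ofReal_comp).const_sub 1).const_mul r
  have dre {F : ℝ → ℂ} {F' : ℂ} {x : ℝ} (hF : HasDerivAt F F' x) :
      HasDerivAt (fun x => (F x).re) F'.re x :=
    Complex.reCLM.hasFDerivAt.comp_hasDerivAt _ hF
  refine ⟨_, fun x => dre (((Complex.hasDerivAt_sinh _).comp x (dl x)).const_mul _), fun x =>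
    (dre ((((Complex.hasDerivAt_cosh _).comp x (dl x)).mul_const (-r)).const_mul _)).congr_deriv ?_,
    by simp, ?_⟩
  · rw [add_zero, ← Complex.re_ofReal_mul, ← hr]
    congr 1
    ring
  · rw [← Complex.ofReal_re σ, Complex.ofReal_zero, sub_zero, mul_one]
    congr 1
    simp only [Complex.ofReal_re]
    field_simp

theorem mem_Delta_iff {a b : ℝ} {k m : ℕ} :
    (k, m) ∈ Delta a b ↔ eig₂ b m - a = -((k + 1 / 2) * π) ^ 2 := by
  change 4 * (b - a) = (4 * (m : ℝ) ^ 2 - (2 * (k : ℝ) + 1) ^ 2) * π ^ 2 ↔ _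
  rw [eig₂]
  constructor <;> intro h <;> linarith

theorem exists_nat_sq_eq_of_cosh_eq_zero {r : ℂ} (hr : Complex.cosh r = 0) :
    ∃ k : ℕ, r ^ 2 = -((k + 1 / 2) * π) ^ 2 := by
  rw [← Complex.cos_mul_I, Complex.cos_eq_zero_iff] at hr
  obtain ⟨j, hj⟩ := hr
  have hr2 : r ^ 2 = -((j + 1 / 2) * π) ^ 2 := by
    linear_combination (-(r * Complex.I) - (2 * j + 1) * π / 2) * hj + r ^ 2 * Complex.I_sq
  rcases Int.eq_nat_or_neg j with ⟨n, rfl | rfl⟩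
  · exact ⟨n, by simpa using hr2⟩
  · cases n with
    | zero => exact ⟨0, by simpa using hr2⟩
    | succ n =>
      refine ⟨n, hr2.trans ?_⟩
      push_cast
      ring

theorem mem_Delta₂_of_cosh_eq_zero {a b : ℝ} {m : ℕ} {r : ℂ}
    (hr : r ^ 2 = ((eig₂ b m - a : ℝ) : ℂ)) (h : Complex.cosh r = 0) : m ∈ Delta₂ a b := by
  obtain ⟨k, hk⟩ := exists_nat_sq_eq_of_cosh_eq_zero h
  exact ⟨k, mem_Delta_iff.mpr (Complex.ofReal_injective (by rw [← hr, hk]; push_cast; rfl))⟩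

end BoundaryValueProblem

section Eigenvectors

open Real

variable (a b s : ℝ) (m : ℕ)

open Classical in
/-- The first component of `(𝒜 - λ_{2,m}) φ_{2,m}`, as a function: it vanishes unless
`λ_{2,m}` coincides with some `λ_{1,k}`. -/
def resonanceFun (x : ℝ) : ℝ :=
  if h : m ∈ Delta₂ a b then -(√2 * s * muCoef m) * phi₁₁ h.choose x else 0

theorem continuous_resonanceFun : Continuous (resonanceFun a b s m) := by
  unfold resonanceFun
  split_ifs
  · exact (continuous_phi₁₁ _).const_mul _
  · exact continuous_const

/-- The first component of `(𝒜 - λ_{2,m}) φ_{2,m}`, as an element of `L²(0,1)`. -/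
def resonance : L2 := toL2 (resonanceFun a b s m) (continuous_resonanceFun a b s m)

/-- The first component of `φ_{2,m}`, as an element of `L²(0,1)`. -/
def phi₂₁L2 : L2 := toL2 (phi₂₁ a b s m) (continuous_phi₂₁ a b s m)

variable {a b m}

theorem resonance_of_mem (h : m ∈ Delta₂ a b) :
    resonance a b s m = -(√2 * s * muCoef m) • cosHalf h.choose := by
  rw [resonance, cosHalf, toL2_smul]
  exact toL2_congr _ _ fun x _ => by rw [resonanceFun, dif_pos h]

theorem toL2_zero : toL2 (fun _ => 0) continuous_const = 0 := by
  simpa using (toL2_smul 0 (F := fun _ => 0) continuous_const).symm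

theorem resonance_of_notMem (h : m ∉ Delta₂ a b) : resonance a b s m = 0 := by
  rw [resonance, ← toL2_zero]
  exact toL2_congr _ _ fun x _ => by rw [resonanceFun, dif_neg h]

variable (a b m)

theorem solvesBVP_phi₂₁ : SolvesBVP (eig₂ b m - a) (s * muCoef m) (resonanceFun a b s m)
    (phi₂₁ a b s m) := by
  by_cases h : m ∈ Delta₂ a b
  · have hk := mem_Delta_iff.mp h.choose_spec
    set w : ℝ := ((h.choose : ℕ) + 1 / 2 : ℝ) * π with hw
    have hcw : s * muCoef m / w * w = s * muCoef m := div_mul_cancel₀ _ (by positivity)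
    convert solvesBVP_one_sub_mul_sin (s * muCoef m / w) w using 1
    · exact hcw.symm
    · funext x
      rw [resonanceFun, dif_pos h, phi₁₁, ← hw, hcw]
      linear_combination -(s * muCoef m * cos (w * x)) * mul_self_sqrt zero_le_two
    · funext x
      rw [phi₂₁, dif_pos h]
      ring
  have hres : resonanceFun a b s m = fun _ => 0 := funext fun x => by rw [resonanceFun, dif_neg h]
  rw [hres]
  by_cases h0 : b - a = (m : ℝ) ^ 2 * π ^ 2
  · convert solvesBVP_linear (s * muCoef m) using 1
    · rw [eig₂]
      linarith
    · funext x
      rw [phi₂₁, dif_neg h, if_pos h0]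
  · have hr := rootR_sq a b m
    have hr₀ : rootR a b m ≠ 0 := fun hr₀ => h0 <| by
      rw [hr₀, zero_pow two_ne_zero, eq_comm, Complex.ofReal_eq_zero, eig₂] at hr
      linarith
    convert solvesBVP_sinh hr hr₀ fun hcosh => h (mem_Delta₂_of_cosh_eq_zero hr hcosh) using 1
    funext x
    rw [phi₂₁, dif_neg h, if_neg h0]

theorem Phi₁_mem_graph (n : ℕ) : (Phi₁ n, eig₁ a n • Phi₁ n) ∈ (coupledOp a b s).graph := by
  have h := mem_graph_of_solvesBVP (a := a) (b := b) (s := s) (ν := 0) (g := fun _ => 0)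
    (g' := fun _ => 0) (continuous_phi₁₁ n) continuous_const continuous_const
    (by rw [mul_zero]; exact solvesBVP_phi₁₁ n) (fun x => hasDerivAt_const x 0)
    (fun x => by simpa using hasDerivAt_const x 0) rfl rfl
  have he : eig₁ a n = a + -((n + 1 / 2) * π) ^ 2 := by rw [eig₁]; ring
  rw [toL2_zero, smul_zero, add_zero, ← he] at h
  rwa [Phi₁, ← WithLp.toLp_smul, Prod.smul_mk, smul_zero]

theorem Phi₂_mem_graph : (Phi₂ a b s m, WithLp.toLp 2
    (eig₂ b m • phi₂₁L2 a b s m + resonance a b s m, eig₂ b m • cosInt m)) ∈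
      (coupledOp a b s).graph := by
  have h := mem_graph_of_solvesBVP (a := a) (b := b) (ν := -(m * π) ^ 2) (continuous_phi₂₁ a b s m)
    (continuous_resonanceFun a b s m) (continuous_phi₂₂ m) (solvesBVP_phi₂₁ a b s m)
    (fun x => (hasDerivAt_mul_cos (muCoef m) (m * π) x).congr_of_eventuallyEq
      (Eventually.of_forall fun x => phi₂₂_eq m x))
    (fun x => (hasDerivAt_mul_sin _ _ x).congr_deriv (by rw [phi₂₂_eq]; ring)) (by simp)
    (by simp [sin_nat_mul_pi])
  have he : b + -(m * π) ^ 2 = eig₂ b m := by rw [eig₂]; ring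
  rwa [add_sub_cancel, he] at h

end Eigenvectors

/-! ### Decay of the first components -/

section Decay

open Real

variable {a b : ℝ} {m : ℕ}

theorem muCoef_le_two (m : ℕ) : muCoef m ≤ 2 := by
  rw [muCoef_eq]
  split_ifs
  · norm_num
  · exact sqrt_le_iff.mpr ⟨by norm_num, by norm_num⟩

theorem sq_le_neg_eig₂_sub (hm : |b - a| + 1 ≤ m) : (m : ℝ) ^ 2 ≤ -(eig₂ b m - a) := by
  have hba := le_abs_self (b - a)
  have h0 := abs_nonneg (b - a)
  have hpi : 9 ≤ π ^ 2 := by nlinarith [pi_gt_three]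
  rw [eig₂]
  nlinarith

theorem half_le_abs_cos_of_abs_sub_le_one {x : ℝ} (hx : |x - m * π| ≤ 1) : 1 / 2 ≤ |cos x| := by
  have habs : |cos x| = |cos (x - m * π)| := by
    rw [cos_sub_nat_mul_pi, abs_mul, abs_pow, abs_neg, abs_one, one_pow, one_mul]
  have hsq : (x - m * π) ^ 2 ≤ 1 := (sq_le_one_iff_abs_le_one _).mpr hx
  rw [habs]
  refine le_trans ?_ (le_abs_self _)
  linarith [one_sub_sq_div_two_le_cos (x := x - m * π)]

/-- `ρ² - (m π)² = a - b` is bounded, so `ρ` is close to `m π`. -/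
theorem half_le_abs_cos {ρ : ℝ} (hm : |b - a| + 1 ≤ m) (hρ₀ : 0 ≤ ρ)
    (hρ : ρ ^ 2 = -(eig₂ b m - a)) : 1 / 2 ≤ |cos ρ| := by
  have hm₁ : (1 : ℝ) ≤ m := by linarith [abs_nonneg (b - a)]
  have hmpi : (m : ℝ) ≤ ρ + m * π := by nlinarith [pi_gt_three]
  refine half_le_abs_cos_of_abs_sub_le_one (m := m) ?_
  have hprod : |ρ - m * π| * (ρ + m * π) = |b - a| := by
    rw [← abs_of_nonneg (a := ρ + m * π) (by linarith), ← abs_mul, ← abs_neg (b - a)]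
    congr 1
    rw [eig₂] at hρ
    linear_combination hρ
  nlinarith [abs_nonneg (ρ - m * π)]

theorem notMem_Delta₂ (hm : |b - a| + 1 ≤ m) : m ∉ Delta₂ a b := by
  rintro ⟨k, hk⟩
  have h := half_le_abs_cos (ρ := (k + 1 / 2) * π) hm (by positivity)
    (by rw [mem_Delta_iff.mp hk, neg_neg])
  norm_num [cos_half_pi k] at h

theorem phi₂₁_eq_sin_div (s : ℝ) (h : m ∉ Delta₂ a b) {ρ : ℝ} (hρ₀ : ρ ≠ 0)
    (hρ : ρ ^ 2 = -(eig₂ b m - a)) (x : ℝ) :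
    phi₂₁ a b s m x = -(s * muCoef m * sin (ρ * (1 - x))) / (ρ * cos ρ) := by
  have hr : ((ρ : ℂ) * Complex.I) ^ 2 = ((eig₂ b m - a : ℝ) : ℂ) := by
    rw [mul_pow, Complex.I_sq, ← Complex.ofReal_pow, hρ]
    push_cast
    ring
  have hne : b - a ≠ (m : ℝ) ^ 2 * π ^ 2 := fun hba => hρ₀ <| by
    rw [eig₂] at hρ
    exact pow_eq_zero_iff two_ne_zero |>.mp (by linarith)
  apply Complex.ofReal_injective
  rw [ofReal_phi₂₁ h hne hr, show (ρ : ℂ) * Complex.I * (1 - (x : ℂ)) =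
    ((ρ * (1 - x) : ℝ) : ℂ) * Complex.I by push_cast; ring, Complex.cosh_mul_I, Complex.sinh_mul_I]
  push_cast
  rw [div_mul_eq_mul_div, mul_right_comm (ρ : ℂ), ← mul_assoc _ _ Complex.I,
    mul_div_mul_right _ _ Complex.I_ne_zero, neg_mul]

theorem abs_phi₂₁_le (s : ℝ) (hm : |b - a| + 1 ≤ m) (x : ℝ) :
    |phi₂₁ a b s m x| ≤ 4 * |s| / m := by
  have hm₀ : (0 : ℝ) < m := by linarith [abs_nonneg (b - a)]
  have hsq := sq_le_neg_eig₂_sub hm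
  set ρ := √(-(eig₂ b m - a))
  have hρ : ρ ^ 2 = -(eig₂ b m - a) := sq_sqrt ((sq_nonneg _).trans hsq)
  have hmρ : (m : ℝ) ≤ ρ := le_sqrt_of_sq_le hsq
  have hρ₀ : 0 < ρ := hm₀.trans_le hmρ
  have hcos := half_le_abs_cos hm hρ₀.le hρ
  rw [phi₂₁_eq_sin_div s (notMem_Delta₂ hm) hρ₀.ne' hρ, abs_div, abs_neg, abs_mul, abs_mul,
    abs_mul, abs_of_pos hρ₀, abs_of_pos (muCoef_pos m),
    div_le_div_iff₀ (by positivity) hm₀]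
  calc |s| * muCoef m * |sin (ρ * (1 - x))| * m ≤ |s| * 2 * 1 * m := by
        gcongr
        exacts [muCoef_le_two m, abs_sin_le_one _]
    _ = 4 * |s| * (m * (1 / 2)) := by ring
    _ ≤ 4 * |s| * (ρ * |cos ρ|) := by gcongr

theorem summable_norm_phi₂₁L2_sq (a b s : ℝ) : Summable fun m => ‖phi₂₁L2 a b s m‖ ^ 2 := by
  have hsum : Summable fun m : ℕ => (4 * |s|) ^ 2 * (1 / (m : ℝ) ^ 2) :=
    (summable_one_div_nat_pow.mpr one_lt_two).mul_left _
  refine hsum.of_norm_bounded_eventually_nat ?_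
  filter_upwards [eventually_ge_atTop ⌈|b - a| + 1⌉₊] with m hm
  rw [norm_pow, norm_norm, mul_one_div, ← div_pow]
  gcongr
  exact norm_toL2_le _ (by positivity) fun x _ => abs_phi₂₁_le s (Nat.ceil_le.mp hm) x

theorem summable_norm_resonance_sq (a b s : ℝ) : Summable fun m => ‖resonance a b s m‖ ^ 2 := by
  refine summable_of_ne_finset_zero (s := Finset.range ⌈|b - a| + 1⌉₊) fun m hm => ?_
  rw [Finset.mem_range, not_lt] at hm
  rw [resonance_of_notMem s (notMem_Delta₂ (Nat.ceil_le.mp hm)), norm_zero, zero_pow two_ne_zero]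

end Decay

/-! ### The Riesz basis -/

section RieszBasis

/-- The operator `(f, g) ↦ (K g, 0)` on `L²(0,1) × L²(0,1)`. -/
def upper (K : L2 →L[ℝ] L2) : H0 →L[ℝ] H0 :=
  ((WithLp.prodContinuousLinearEquiv 2 ℝ L2 L2).symm : L2 × L2 →L[ℝ] H0) ∘L
    (ContinuousLinearMap.inl ℝ L2 L2 ∘L K ∘L ContinuousLinearMap.snd ℝ L2 L2) ∘L
      (WithLp.prodContinuousLinearEquiv 2 ℝ L2 L2 : H0 →L[ℝ] L2 × L2)

theorem upper_apply (K : L2 →L[ℝ] L2) (u : H0) : upper K u = WithLp.toLp 2 (K u.snd, 0) := rfl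

theorem upper_upper (K K' : L2 →L[ℝ] L2) (u : H0) : upper K (upper K' u) = 0 := by
  simp [upper_apply]

/-- The isomorphism `(f, g) ↦ (f + K g, g)` of `L²(0,1) × L²(0,1)`. -/
def shear (K : L2 →L[ℝ] L2) : H0 ≃L[ℝ] H0 :=
  ContinuousLinearEquiv.equivOfInverse (ContinuousLinearMap.id ℝ H0 + upper K)
    (ContinuousLinearMap.id ℝ H0 - upper K)
    (fun u => by simp [upper_upper]) (fun u => by simp [upper_upper])

theorem shear_apply (K : L2 →L[ℝ] L2) (u : H0) : shear K u = u + upper K u := rfl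

theorem cosBasis_inl (n : ℕ) : cosBasis (Sum.inl n) = WithLp.toLp 2 (cosHalf n, 0) := by
  rw [coe_cosBasis, cosFamily, Sum.elim_inl]

theorem cosBasis_inr (m : ℕ) : cosBasis (Sum.inr m) = WithLp.toLp 2 (0, cosInt m) := by
  rw [coe_cosBasis, cosFamily, Sum.elim_inr]

theorem upper_cosBasis_inl (K : L2 →L[ℝ] L2) (n : ℕ) : upper K (cosBasis (Sum.inl n)) = 0 := by
  simp [upper_apply, cosBasis_inl]

theorem upper_cosBasis_inr (K : L2 →L[ℝ] L2) (m : ℕ) :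
    upper K (cosBasis (Sum.inr m)) = WithLp.toLp 2 (K (cosInt m), 0) := by
  simp [upper_apply, cosBasis_inr]

variable (a b s : ℝ)

/-- The isomorphism taking the cosine basis to the family `Phi`. -/
def rieszMap : H0 ≃L[ℝ] H0 := shear (synthesisOp cosIntBasis (summable_norm_phi₂₁L2_sq a b s))

/-- The nilpotent part of `coupledOp`, transported to the cosine basis by `rieszMap`. -/
def nilpotentPart : H0 →L[ℝ] H0 :=
  upper (synthesisOp cosIntBasis (summable_norm_resonance_sq a b s))

theorem nilpotentPart_nilpotentPart (u : H0) :
    nilpotentPart a b s (nilpotentPart a b s u) = 0 :=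
  upper_upper _ _ u

theorem nilpotentPart_cosBasis_inr (m : ℕ) : nilpotentPart a b s (cosBasis (Sum.inr m)) =
    WithLp.toLp 2 (resonance a b s m, 0) := by
  rw [nilpotentPart, upper_cosBasis_inr, ← coe_cosIntBasis, synthesisOp_apply_basis]

theorem rieszMap_cosBasis (i : ℕ ⊕ ℕ) : rieszMap a b s (cosBasis i) = Phi a b s i := by
  rcases i with n | m
  · rw [rieszMap, shear_apply, upper_cosBasis_inl, add_zero, cosBasis_inl]
    rfl
  · rw [rieszMap, shear_apply, upper_cosBasis_inr, ← coe_cosIntBasis, synthesisOp_apply_basis,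
      cosBasis_inr, ← WithLp.toLp_add, Prod.mk_add_mk, zero_add, add_zero]
    rfl

theorem isRieszBasis_Phi : IsRieszBasis (Phi a b s) :=
  ⟨cosBasis, rieszMap a b s, fun i => (rieszMap_cosBasis a b s i).symm⟩

theorem inner_cosBasis_nilpotentPart (i j : ℕ ⊕ ℕ) (hij : eig a b j ≠ eig a b i) :
    inner ℝ (cosBasis j) (nilpotentPart a b s (cosBasis i)) = 0 := by
  rcases i with n | m
  · rw [nilpotentPart, upper_cosBasis_inl, inner_zero_right]
  rw [nilpotentPart_cosBasis_inr]
  rcases j with n | m'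
  · rw [cosBasis_inl, WithLp.prod_inner_apply]
    by_cases h : m ∈ Delta₂ a b
    · have hn : n ≠ h.choose := by
        rintro rfl
        refine hij ?_
        have hres := mem_Delta_iff.mp h.choose_spec
        change eig₁ a h.choose = eig₂ b m
        rw [eig₁]
        linarith
      simp [resonance_of_mem s h, inner_smul_right, orthonormal_cosHalf.inner_eq_zero hn]
    · simp [resonance_of_notMem s h]
  · simp [cosBasis_inr, WithLp.prod_inner_apply]

theorem rieszMap_cosBasis_mem_graph (i : ℕ ⊕ ℕ) : (rieszMap a b s (cosBasis i),
    rieszMap a b s (eig a b i • cosBasis i + nilpotentPart a b s (cosBasis i))) ∈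
      (coupledOp a b s).graph := by
  rw [map_add, map_smul, rieszMap_cosBasis]
  rcases i with n | m
  · rw [nilpotentPart, upper_cosBasis_inl, map_zero, add_zero]
    exact Phi₁_mem_graph a b s n
  · have hres : rieszMap a b s (WithLp.toLp 2 (resonance a b s m, 0)) =
        WithLp.toLp 2 (resonance a b s m, 0) := by
      simp [rieszMap, shear_apply, upper_apply]
    rw [nilpotentPart_cosBasis_inr, hres]
    simpa [eig, Phi, Phi₂, phi₂₁L2, cosInt, ← WithLp.toLp_add, ← WithLp.toLp_smul] using
      Phi₂_mem_graph a b s m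

theorem eig_le_max (i : ℕ ⊕ ℕ) : eig a b i ≤ max a b := by
  rcases i with n | m
  · exact (sub_le_self a (by positivity)).trans (le_max_left a b)
  · exact (sub_le_self b (by positivity)).trans (le_max_right a b)

theorem jordanGraph_le_graph_coupledOp :
    jordanGraph cosBasis (eig a b) (nilpotentPart a b s) (rieszMap a b s) ≤
      (coupledOp a b s).graph :=
  jordanGraph_le (isClosed_coupledOp a b s) (rieszMap_cosBasis_mem_graph a b s)

theorem isGeneralizedEigenvector_Phi (i : ℕ ⊕ ℕ) :
    IsGeneralizedEigenvector (coupledOp a b s) (eig a b i) (Phi a b s i) :=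
  rieszMap_cosBasis a b s i ▸ isGeneralizedEigenvector_of_jordanGraph_le
    (inner_cosBasis_nilpotentPart a b s) (nilpotentPart_nilpotentPart a b s)
    (jordanGraph_le_graph_coupledOp a b s) i

/-- To the right of the spectrum, `l - jordanGraph` is onto and `l - coupledOp` is injective. -/
theorem graph_coupledOp_eq_jordanGraph : (coupledOp a b s).graph =
    jordanGraph cosBasis (eig a b) (nilpotentPart a b s) (rieszMap a b s) := by
  have hl := lt_add_one (max a b)
  refine (submodule_eq_of_surjective_of_injective (jordanGraph_le_graph_coupledOp a b s)
    (l := max a b + 1) ?_ fun u hu => ?_).symm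
  · exact exists_mem_jordanGraph (inner_cosBasis_nilpotentPart a b s)
      (nilpotentPart_nilpotentPart a b s) (eig_le_max a b) hl (rieszMap a b s)
  · exact eq_zero_of_smul_mem_graph_coupledOp ((le_max_left a b).trans_lt hl)
      ((le_max_right a b).trans_lt hl) hu

theorem generatesC0Semigroup_coupledOp : GeneratesC0Semigroup (coupledOp a b s) :=
  generatesC0Semigroup_of_graph_eq_jordanGraph (inner_cosBasis_nilpotentPart a b s)
    (nilpotentPart_nilpotentPart a b s) (eig_le_max a b) (graph_coupledOp_eq_jordanGraph a b s)

end RieszBasis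

end HeatCascade

end

theorem mainTheorem4 (a b s : ℝ) (hs : s ≠ 0) :
    (∀ i : ℕ ⊕ ℕ, HeatCascade.IsGeneralizedEigenvector (HeatCascade.coupledOp a b s)
      (HeatCascade.eig a b i) (HeatCascade.Phi a b s i)) ∧
    HeatCascade.IsRieszBasis (HeatCascade.Phi a b s) ∧
    HeatCascade.GeneratesC0Semigroup (HeatCascade.coupledOp a b s) :=
  ⟨HeatCascade.isGeneralizedEigenvector_Phi a b s, HeatCascade.isRieszBasis_Phi a b s,
    HeatCascade.generatesC0Semigroup_coupledOp a b s⟩
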